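/- Let $G$ be a connected, simply connected nilpotent (real, finite-dimensional) Lie group with Lie algebra $\mathfrak g$, exponential map $\exp:\mathfrak g\to G$ (a diffeomorphism) with inverse $\log$, and Haar measure $dx$. Let $\mathfrak g^\sharp$ be the dual of $\mathfrak g$, and write $\langle X|\xi\rangle=\xi(X)$. Equip $\mathfrak g$ with the Haar measure $dX$ that corresponds to $dx$ through $\exp$, $\mathfrak g^\sharp$ with the Haar measure $d\xi$ for which the Fourier transformation $h\mapsto\int_{\mathfrak g}e^{-i\langle X|\cdot\rangle}h(X)\,dX$ is unitary from $L^2(\mathfrak g)$ onto $L^2(\mathfrak g^\sharp)$, and $\Xi:=G\times\mathfrak g^\sharp$ with the product measure. Let $\omega\in L^2(G)$ with $\|\omega\|_{L^2}=1$ (for instance a normalized Schwartz function). For $\mathcal X=(z,\zeta)\in\Xi$ define the coherent state $$\omega_{z,\zeta}(x):=e^{-i\langle\log(zx)|\zeta\rangle}\,\omega(zx),$$ that is, $\omega_{z,\zeta}=W(z,\zeta)^*\omega$ for the unitary operator $[W(z,\zeta)u](x)=e^{i\langle\log x|\zeta\rangle}u(z^{-1}x)$ on $L^2(G)$, and define the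 diagonal covariant symbol of a bounded operator $T$ on $L^2(G)$ by $$[\mathrm{Cov}_\omega(T)](\mathcal X):=\langle T\omega_{\mathcal X},\omega_{\mathcal X}\rangle,\qquad \mathcal X\in\Xi.$$ For $p\in[1,\infty)$ let $\mathbb B^p=\mathbb B^p[L^2(G)]$ be the Schatten-von Neumann class of exponent $p$, i.e. the compact operators whose singular values (counted with multiplicity) are in $\ell^p$, with the $\ell^p$ norm of the singular values, and let $\mathbb B^\infty$ be the space of compact operators with the operator norm. If $p\in[1,\infty]$ and $T\in\mathbb B^p[L^2(G)]$, then $\mathrm{Cov}_\omega(T)\in L^p(\Xi)$ and $$\|\mathrm{Cov}_\omega(T)\|_{L^p(\Xi)}\le\|T\|_{\mathbb B^p}.$$ -/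

import Mathlib

open MeasureTheory Module
open scoped Manifold ContDiff ENNReal InnerProductSpace

noncomputable section

/-! ### Schatten-von Neumann classes on a complex Hilbert space -/

section Schatten

variable {H : Type*} [NormedAddCommGroup H] [InnerProductSpace ℂ H] [CompleteSpace H]

/-- The multiplicity of `s` as a singular value of `T`: the dimension of the eigenspace of `T† T`
for the eigenvalue `s ^ 2` (finite if `T` is compact and `s > 0`). -/
def singularMultiplicity (T : H →L[ℂ] H) (s : ℝ) : ℕ :=
  finrank ℂ (End.eigenspace
    ((ContinuousLinearMap.adjoint T ∘L T : H →L[ℂ] H) : H →ₗ[ℂ] H) (((s ^ 2 : ℝ)) : ℂ))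

open Classical in
/-- The Schatten norm of exponent `p` of a compact operator, as an extended real: the `ℓ^p` norm of
the family of its positive singular values, each counted with its multiplicity, if `p < ∞`,
and the operator norm if `p = ∞`. -/
def schattenNorm (p : ℝ≥0∞) (T : H →L[ℂ] H) : ℝ≥0∞ :=
  if p = ⊤ then ‖T‖ₑ
  else (∑' s : Set.Ioi (0 : ℝ),
    (singularMultiplicity T s : ℝ≥0∞) * ENNReal.ofReal s ^ p.toReal) ^ (1 / p.toReal)

/-- `T` belongs to the Schatten-von Neumann class of exponent `p`. For `p = ∞` this is the class of
all compact operators. -/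
def MemSchatten (p : ℝ≥0∞) (T : H →L[ℂ] H) : Prop :=
  IsCompactOperator T ∧ schattenNorm p T < ⊤

end Schatten

/-! ### Exponential map, logarithm and Haar measures -/

section LieGroup

variable {E : Type*} [NormedAddCommGroup E] [NormedSpace ℝ E]
  {G : Type*} [TopologicalSpace G] [ChartedSpace E G] [Group G]

/-- A smooth real Lie group has the smoothness that Mathlib asks for to define its Lie algebra. -/
instance instLieGroupMinSmoothness [LieGroup 𝓘(ℝ, E) ∞ G] :
    LieGroup 𝓘(ℝ, E) (minSmoothness ℝ 3) G :=
  LieGroup.of_le (n := ∞) (by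
    rw [minSmoothness_of_isRCLikeNormedField]
    exact ENat.LEInfty.out)

open Classical in
/-- The exponential map of a Lie group: `exp X = γ 1`, where `γ` is the integral curve with
`γ 0 = 1` of the left-invariant vector field defined by `X`. (This curve exists and is unique, so
that the second branch is never used.) -/
def lieExp (X : GroupLieAlgebra 𝓘(ℝ, E) G) : G :=
  if h : ∃ γ : ℝ → G, γ 0 = 1 ∧
      IsMIntegralCurve (I := 𝓘(ℝ, E)) γ (mulInvariantVectorField (I := 𝓘(ℝ, E)) X) then
    h.choose 1
  else 1

/-- The logarithm, inverse of the exponential map. Its values are in the Lie algebra of `G`, that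
is, the tangent space of `G` at `1`, which Mathlib identifies with the model space `E`. -/
def lieLog (x : G) : E :=
  Function.invFun (lieExp : GroupLieAlgebra 𝓘(ℝ, E) G → G) x

/-- The measure `dX` on the Lie algebra which corresponds through the exponential map to the
Haar measure `μ` of the group. -/
def lieAlgebraHaar [MeasurableSpace E] [MeasurableSpace G] (μ : Measure G) : Measure E :=
  μ.map lieLog

variable [FiniteDimensional ℝ E]

/-- The basis of the dual space which is dual to a given basis. -/
def strongDualBasis {ι : Type*} [Fintype ι] (b : Basis ι ℝ E) :
    Basis ι ℝ (StrongDual ℝ E) := by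
  classical
  exact b.dualBasis.map (LinearMap.toContinuousLinearMap : (E →ₗ[ℝ] ℝ) ≃ₗ[ℝ] (E →L[ℝ] ℝ))

/-- The Haar measure on the dual space `E♯` dual to the Haar measure `m` on `E`, i.e. normalized
such that the Fourier transformation `h ↦ ∫ e^{-i⟨X|ξ⟩} h(X) dm(X)` is unitary from `L²(E, m)` onto
`L²(E♯)`: if `m` is `c` times the Lebesgue measure of a basis of `E`, then it is
`((2π)ⁿ c)⁻¹` times the Lebesgue measure of the dual basis. -/
def dualHaar [MeasurableSpace E] (m : Measure E) : Measure (StrongDual ℝ E) :=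
  (ENNReal.ofReal ((2 * Real.pi) ^ finrank ℝ E) * m (parallelepiped (finBasis ℝ E)))⁻¹ •
    (strongDualBasis (finBasis ℝ E)).addHaar

variable [MeasurableSpace E] [MeasurableSpace G]

/-- The measure `dz dζ` on the phase space `Ξ = G × 𝔤♯`. -/
def phaseMeasure (μ : Measure G) : Measure (G × StrongDual ℝ E) :=
  μ.prod (dualHaar (lieAlgebraHaar μ))

end LieGroup

/-! ### Weyl system, coherent states and covariant symbols -/

section Coherent

variable {E : Type*} [NormedAddCommGroup E] [NormedSpace ℝ E]
  {G : Type*} [TopologicalSpace G] [ChartedSpace E G] [Group G]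

/-- The operator `W(z, ζ)` of the Weyl system, `[W(z, ζ) u](x) = e^{i⟨log x|ζ⟩} u(z⁻¹ x)`, on
functions. -/
def weyl (z : G) (ζ : StrongDual ℝ E) (u : G → ℂ) (x : G) : ℂ :=
  Complex.exp (Complex.I * (ζ (lieLog x) : ℂ)) * u (z⁻¹ * x)

/-- The adjoint of `W(z, ζ)`, `[W(z, ζ)* u](x) = e^{-i⟨log(zx)|ζ⟩} u(z x)`, on functions. -/
def weylAdjoint (z : G) (ζ : StrongDual ℝ E) (u : G → ℂ) (x : G) : ℂ :=
  Complex.exp (-(Complex.I * (ζ (lieLog (z * x)) : ℂ))) * u (z * x)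

/-- On functions, `W(z, ζ)*` is the inverse of `W(z, ζ)`. -/
theorem weyl_weylAdjoint (z : G) (ζ : StrongDual ℝ E) (u : G → ℂ) :
    weyl z ζ (weylAdjoint z ζ u) = u := by
  funext x
  simp [weyl, weylAdjoint, ← mul_assoc, ← Complex.exp_add]

variable [MeasurableSpace G]

open Classical in
/-- The coherent state `w_{z,ζ} = W(z, ζ)* w` in `L²(G)`. (`W(z, ζ)*` preserves `L²(G)` when `μ` is
a Haar measure, so that the second branch is not used.) -/
def coherentState (μ : Measure G) (w : Lp ℂ 2 μ) (X : G × StrongDual ℝ E) : Lp ℂ 2 μ :=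
  if h : MemLp (weylAdjoint X.1 X.2 w) 2 μ then h.toLp _ else 0

/-- The covariant symbol `cov_w(T)(X, X') = ⟨T w_X, w_{X'}⟩` of a bounded operator on `L²(G)`.
(Mathlib's inner product is conjugate-linear in its first variable.) -/
def covariantSymbol (μ : Measure G) (w : Lp ℂ 2 μ) (T : Lp ℂ 2 μ →L[ℂ] Lp ℂ 2 μ)
    (X X' : G × StrongDual ℝ E) : ℂ :=
  ⟪coherentState μ w X', T (coherentState μ w X)⟫_ℂ

/-- The diagonal covariant symbol `Cov_w(T)(X) = ⟨T w_X, w_X⟩`. -/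
def diagCovariantSymbol (μ : Measure G) (w : Lp ℂ 2 μ) (T : Lp ℂ 2 μ →L[ℂ] Lp ℂ 2 μ)
    (X : G × StrongDual ℝ E) : ℂ :=
  covariantSymbol μ w T X X

end Coherent

end

/-! The bound holds for every family of unit vectors `a x` in a Hilbert space with the Bessel
inequality `∫ |⟨u, a x⟩|² dx ≤ ‖u‖²`. Let `s i` be the singular values of `T`, with singular vectors
`e i` and `f i`. Then `|⟨a, T a⟩| ≤ ∑ s i |⟨e i, a⟩| |⟨f i, a⟩|`, and for a unit vector `a` the
weights `|⟨e i, a⟩| |⟨f i, a⟩|` have sum at most 1 by Cauchy-Schwarz and Bessel. Jensen's inequality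
moves the power `p` onto the `s i`. By Cauchy-Schwarz and the Bessel inequality of the family, the
integral over `x` of each weight is at most 1, and `∑ s i ^ p` remains
(`lintegral_enorm_inner_rpow_le`). The case `p = ∞` is just Cauchy-Schwarz.

For coherent states, Bessel is `lintegral_inner_coherentState_sq_le`. For fixed `z`, the coefficient
of `u` is, up to conjugation, the Fourier transform in `ζ`, in logarithmic coordinates, of `y ↦ conj
(w y) * u (z⁻¹ y)`. Plancherel in `ζ` (`lintegral_dualHaar_sq`), then Tonelli and unimodularity,
give `‖w‖² ‖u‖²`.

This requires that `exp` is a homeomorphism which carries Lebesgue measure to Haar measure. By the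
bracket relation for the left-invariant frame and differentiable dependence of ODE solutions on
parameters, the left logarithmic derivative of `exp` at `X` is `J(X) = (1 - e^{-ad X}) / ad X`, a
unipotent polynomial in `ad X`. The equation `u' = J(u)⁻¹ Y` is solved exactly by finitely many
Picard iterations, since each one gains a step of the central series; its solution gives a product
on the Lie algebra which `exp` sends to the product of `G`. This product trivializes `exp` locally,
so `exp` is a covering map, and a homeomorphism as `G` is simply connected. Left translations in
exponential coordinates have derivative `J(T Y)⁻¹ J(Y)`, of determinant 1, so Lebesgue measure
becomes left invariant; inversion becomes `X ↦ -X`, whence unimodularity. -/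

noncomputable section

/-! ### Nilpotent brackets and the polynomials of their adjoint operators -/

section NilpotentBracket

variable {E : Type*} [NormedAddCommGroup E] [NormedSpace ℝ E]

/-- A continuous alternating bilinear map `ad` which sends `E × C k` to `C (k + 1)` for a decreasing
filtration `C` with `C 0 = ⊤` and `C N = ⊥`. -/
structure IsNilpotentBracket (ad : E →L[ℝ] E →L[ℝ] E) (C : ℕ → Submodule ℝ E) (N : ℕ) : Prop where
  zero_eq_top : C 0 = ⊤
  eq_bot : C N = ⊥
  antitone : Antitone C
  mem_succ : ∀ k x y, y ∈ C k → ad x y ∈ C (k + 1)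
  skew : ∀ x y, ad x y = - ad y x

/-- `∑_{j ≤ N} (-1)^j t^(j+1) / (j+1)! B^j`, which is `(1 - e^{-tB}) / B` if `B ^ (N + 1) = 0`. -/
def expJacobian (N : ℕ) (t : ℝ) (B : E →L[ℝ] E) : E →L[ℝ] E :=
  ∑ j ∈ Finset.range (N + 1), ((-1) ^ j * t ^ (j + 1) / (j + 1).factorial) • B ^ j

/-- The inverse of `expJacobian N 1 B` for nilpotent `B`. -/
def expJacobianInv (N : ℕ) (B : E →L[ℝ] E) : E →L[ℝ] E :=
  ∑ k ∈ Finset.range N, (1 - expJacobian N 1 B) ^ k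

theorem expJacobian_zero (N : ℕ) (B : E →L[ℝ] E) : expJacobian N 0 B = 0 := by
  simp [expJacobian]

/-- At time 1 the term `j = 0` is the identity, so the difference has no constant term in `B`; this
is what makes it nilpotent and the geometric series a finite inverse. -/
theorem one_sub_expJacobian (N : ℕ) (B : E →L[ℝ] E) : 1 - expJacobian N 1 B =
    ∑ j ∈ Finset.range N, (- ((-1) ^ (j + 1) / (j + 2).factorial : ℝ)) • B ^ (j + 1) := by
  rw [expJacobian, Finset.sum_range_succ']
  simp [neg_smul]

theorem continuous_expJacobian (N : ℕ) (t : ℝ) :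
    Continuous (expJacobian N t : (E →L[ℝ] E) → E →L[ℝ] E) := by
  unfold expJacobian
  fun_prop

theorem continuous_expJacobianInv (N : ℕ) :
    Continuous (expJacobianInv N : (E →L[ℝ] E) → E →L[ℝ] E) := by
  have := continuous_expJacobian (E := E) N 1
  unfold expJacobianInv
  fun_prop

/-- The truncation costs nothing: the only term that breaks `Ψ' = 1 - B Ψ` is the one in `B ^ (N +
1)`. This equation is the one that the derivative of `exp (t X)` in `X` has to satisfy. -/
theorem hasDerivAt_expJacobian {N : ℕ} {B : E →L[ℝ] E} (hB : B ^ (N + 1) = 0) (t : ℝ) :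
    HasDerivAt (fun t ↦ expJacobian N t B) (1 - B * expJacobian N t B) t := by
  have h1 : HasDerivAt (fun t ↦ expJacobian N t B)
      (∑ j ∈ Finset.range (N + 1), ((-1) ^ j * t ^ j / j.factorial) • B ^ j) t := by
    unfold expJacobian
    apply HasDerivAt.fun_sum
    intro j _
    have := ((hasDerivAt_pow (j + 1) t).const_mul ((-1 : ℝ) ^ j)).div_const
      ((j + 1).factorial : ℝ)
    refine HasDerivAt.smul_const (𝕜 := ℝ) (𝕜' := ℝ) ?_ (B ^ j)
    convert this using 1
    have h2 : ((j : ℝ) + 1) ≠ 0 := by positivity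
    have h3 : (j.factorial : ℝ) ≠ 0 := by positivity
    rw [Nat.factorial_succ]
    push_cast
    field_simp
  convert h1 using 1
  rw [Finset.sum_range_succ', expJacobian, Finset.sum_range_succ, mul_add, Finset.mul_sum,
    mul_smul_comm _ B, ← pow_succ', hB]
  simp only [smul_zero, add_zero, pow_zero, Nat.factorial_zero, Nat.cast_one, mul_one, div_one,
    one_smul, mul_smul_comm, ← pow_succ']
  rw [sub_eq_neg_add, ← Finset.sum_neg_distrib]
  congr 1
  refine Finset.sum_congr rfl fun j _ ↦ ?_
  rw [← neg_smul]
  congr 1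
  rw [pow_succ' (-1 : ℝ) j]
  ring

namespace IsNilpotentBracket

variable {ad : E →L[ℝ] E →L[ℝ] E} {C : ℕ → Submodule ℝ E} {N : ℕ}

theorem pow_mem (h : IsNilpotentBracket ad C N) (x y : E) (k j : ℕ) (hy : y ∈ C k) :
    (ad x ^ j) y ∈ C (k + j) := by
  induction j with
  | zero => simpa using hy
  | succ j ih => rw [pow_succ']; exact h.mem_succ _ _ _ ih

theorem pow_eq_zero (h : IsNilpotentBracket ad C N) (x : E) : ad x ^ (N + 1) = 0 := by
  ext y
  have := h.pow_mem x y 0 (N + 1) (by simp [h.zero_eq_top])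
  have h2 := h.antitone (Nat.le_succ N) (by simpa using this)
  simpa [h.eq_bot] using h2

theorem one_sub_expJacobian_mem (h : IsNilpotentBracket ad C N) (x y : E) (k : ℕ) (hy : y ∈ C k) :
    (1 - expJacobian N 1 (ad x)) y ∈ C (k + 1) := by
  rw [one_sub_expJacobian, sum_apply]
  refine Submodule.sum_mem _ fun j _ ↦ Submodule.smul_mem _ _ ?_
  exact h.antitone (by omega) (h.pow_mem x y k (j + 1) hy)

theorem one_sub_expJacobian_pow (h : IsNilpotentBracket ad C N) (x : E) :
    (1 - expJacobian N 1 (ad x)) ^ N = 0 := by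
  have key : ∀ j y, ((1 - expJacobian N 1 (ad x)) ^ j) y ∈ C j := by
    intro j
    induction j with
    | zero => simp [h.zero_eq_top]
    | succ j ih =>
      intro y
      rw [pow_succ']
      exact h.one_sub_expJacobian_mem _ _ _ (ih y)
  ext y
  simpa [h.eq_bot] using key N y

theorem expJacobian_mul_inv (h : IsNilpotentBracket ad C N) (x : E) :
    expJacobian N 1 (ad x) * expJacobianInv N (ad x) = 1 := by
  have := mul_neg_geom_sum (1 - expJacobian N 1 (ad x)) N
  rw [sub_sub_cancel, h.one_sub_expJacobian_pow, sub_zero] at this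
  exact this

theorem expJacobianInv_mul (h : IsNilpotentBracket ad C N) (x : E) :
    expJacobianInv N (ad x) * expJacobian N 1 (ad x) = 1 := by
  have := geom_sum_mul_neg (1 - expJacobian N 1 (ad x)) N
  rw [sub_sub_cancel, h.one_sub_expJacobian_pow, sub_zero] at this
  exact this

/-- The operator is `1 - M` with `M` nilpotent, and `det (1 - M)` is the value at 1 of the
characteristic polynomial of `M`, a power of the variable. This is why Lebesgue measure is Haar
measure. -/
theorem det_expJacobian (h : IsNilpotentBracket ad C N) [FiniteDimensional ℝ E] (x : E) :
    (expJacobian N 1 (ad x)).det = 1 := by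
  set M : E →ₗ[ℝ] E := ((1 - expJacobian N 1 (ad x) : E →L[ℝ] E) : E →ₗ[ℝ] E) with hM
  have hMn : IsNilpotent M := by
    refine ⟨N, ?_⟩
    ext y
    have := congrArg (fun T : E →L[ℝ] E ↦ T y) (h.one_sub_expJacobian_pow x)
    rw [hM, ← ContinuousLinearMap.toLinearMap_pow]
    exact this
  have h1 := (LinearMap.charpoly_eq_X_pow_iff M).2
    (fun m ↦ by obtain ⟨n, hn⟩ := hMn; exact ⟨n, by rw [hn]; rfl⟩)
  have h2 : M.charpoly.eval 1 = LinearMap.det (1 - M) := by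
    rw [LinearMap.eval_charpoly]
    simp
  rw [h1] at h2
  have h3 : ((expJacobian N 1 (ad x) : E →L[ℝ] E) : E →ₗ[ℝ] E) = 1 - M := by
    ext y; simp [hM]
  rw [ContinuousLinearMap.det, h3, ← h2]
  simp

/-- Two operators which respect the filtration and agree modulo `C (k + 1)`. -/
def Agree (C : ℕ → Submodule ℝ E) (k : ℕ) (P Q : E →L[ℝ] E) : Prop :=
  (∀ j, ∀ y ∈ C j, P y ∈ C j) ∧ (∀ j, ∀ y ∈ C j, Q y ∈ C j) ∧ ∀ y, P y - Q y ∈ C (k + 1)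

theorem Agree.one {k : ℕ} : Agree C k (1 : E →L[ℝ] E) 1 :=
  ⟨fun _ _ h ↦ h, fun _ _ h ↦ h, fun y ↦ by simp⟩

theorem Agree.mul {k : ℕ} {P Q P' Q' : E →L[ℝ] E} (h : Agree C k P Q) (h' : Agree C k P' Q') :
    Agree C k (P * P') (Q * Q') := by
  refine ⟨fun j y hy ↦ h.1 _ _ (h'.1 _ _ hy), fun j y hy ↦ h.2.1 _ _ (h'.2.1 _ _ hy), fun y ↦ ?_⟩
  have : (P * P') y - (Q * Q') y = P (P' y - Q' y) + (P (Q' y) - Q (Q' y)) := by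
    simp
  rw [this]
  exact add_mem (h.1 _ _ (h'.2.2 y)) (h.2.2 _)

theorem Agree.pow {k : ℕ} {P Q : E →L[ℝ] E} (h : Agree C k P Q) (n : ℕ) :
    Agree C k (P ^ n) (Q ^ n) := by
  induction n with
  | zero => simpa using Agree.one
  | succ n ih => rw [pow_succ, pow_succ]; exact ih.mul h

theorem Agree.smul {k : ℕ} {P Q : E →L[ℝ] E} (h : Agree C k P Q) (c : ℝ) :
    Agree C k (c • P) (c • Q) := by
  refine ⟨fun j y hy ↦ Submodule.smul_mem _ _ (h.1 _ _ hy),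
    fun j y hy ↦ Submodule.smul_mem _ _ (h.2.1 _ _ hy), fun y ↦ ?_⟩
  simpa [smul_sub] using Submodule.smul_mem _ c (h.2.2 y)

theorem Agree.sum {k : ℕ} {ι : Type*} (s : Finset ι) {P Q : ι → E →L[ℝ] E}
    (h : ∀ i ∈ s, Agree C k (P i) (Q i)) : Agree C k (∑ i ∈ s, P i) (∑ i ∈ s, Q i) := by
  refine ⟨fun j y hy ↦ ?_, fun j y hy ↦ ?_, fun y ↦ ?_⟩
  · rw [sum_apply]
    exact Submodule.sum_mem _ fun i hi ↦ (h i hi).1 _ _ hy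
  · rw [sum_apply]
    exact Submodule.sum_mem _ fun i hi ↦ (h i hi).2.1 _ _ hy
  · rw [sum_apply, sum_apply, ← Finset.sum_sub_distrib]
    exact Submodule.sum_mem _ fun i hi ↦ (h i hi).2.2 _

/-- The filtration hypothesis concerns the second argument of the bracket only; skew symmetry moves
`u - v` there. -/
theorem agree_ad (h : IsNilpotentBracket ad C N) {k : ℕ} {u v : E} (huv : u - v ∈ C k) :
    Agree C k (ad u) (ad v) := by
  refine ⟨fun j y hy ↦ h.antitone j.le_succ (h.mem_succ _ _ _ hy),
    fun j y hy ↦ h.antitone j.le_succ (h.mem_succ _ _ _ hy), fun y ↦ ?_⟩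
  rw [← sub_apply, ← map_sub, h.skew]
  exact neg_mem (h.mem_succ _ _ _ huv)

/-- Agreement passes to polynomials without constant term in `ad`, then to their powers. The gain
from `C k` to `C (k + 1)` replaces the contraction estimate in the Picard iteration. -/
theorem expJacobianInv_sub_mem (h : IsNilpotentBracket ad C N) {k : ℕ} {u v : E}
    (huv : u - v ∈ C k) (y : E) :
    expJacobianInv N (ad u) y - expJacobianInv N (ad v) y ∈ C (k + 1) := by
  refine (Agree.sum _ fun j _ ↦ Agree.pow ?_ j).2.2 y
  rw [one_sub_expJacobian, one_sub_expJacobian]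
  exact Agree.sum _ fun j _ ↦ ((h.agree_ad huv).pow _).smul _

end IsNilpotentBracket

/-! ### Terminating Picard iteration for the group law on the Lie algebra. -/

theorem Submodule.intervalIntegral_mem [FiniteDimensional ℝ E] (S : Submodule ℝ E) {f : ℝ → E}
    (hf : Continuous f) (hS : ∀ s, f s ∈ S) (a b : ℝ) : ∫ s in a..b, f s ∈ S := by
  have : IsClosed (S : Set E) := S.closed_of_finiteDimensional
  -- The quotient map by `S` kills the integrand, hence the integral.
  have h := (LinearMap.toContinuousLinearMap S.mkQ).intervalIntegral_comp_comm
    (hf.intervalIntegrable (μ := volume) a b)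
  have h0 : ∀ s, LinearMap.toContinuousLinearMap S.mkQ (f s) = 0 := fun s ↦ by
    simpa using hS s
  simp only [h0, intervalIntegral.integral_zero] at h
  simpa using h.symm

/-- The Picard iterates of the equation `u' = expJacobianInv N (ad u) Y`, `u 0 = X`. -/
def picardIter (ad : E →L[ℝ] E →L[ℝ] E) (N : ℕ) : ℕ → E × E × ℝ → E
  | 0, p => p.1
  | n + 1, p => p.1 + ∫ s in (0 : ℝ)..p.2.2,
      expJacobianInv N (ad (picardIter ad N n (p.1, p.2.1, s))) p.2.1

theorem continuous_picardIter (ad : E →L[ℝ] E →L[ℝ] E) (N n : ℕ) :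
    Continuous (picardIter ad N n) := by
  induction n with
  | zero => exact continuous_fst
  | succ n ih =>
    refine continuous_fst.add ?_
    refine intervalIntegral.continuous_parametric_intervalIntegral_of_continuous
      (f := fun (p : E × E × ℝ) s ↦
        expJacobianInv N (ad (picardIter ad N n (p.1, p.2.1, s))) p.2.1) ?_ (by fun_prop)
    have h1 := continuous_expJacobianInv (E := E) N
    simp only [Function.uncurry_def]
    fun_prop

/-- The solution at time `t` of `u' = expJacobianInv N (ad u) Y`, `u 0 = X`. -/
def bchFlow (ad : E →L[ℝ] E →L[ℝ] E) (N : ℕ) (X Y : E) (t : ℝ) : E := picardIter ad N N (X, Y, t)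

theorem continuous_bchFlow (ad : E →L[ℝ] E →L[ℝ] E) (N : ℕ) :
    Continuous fun p : E × E × ℝ ↦ bchFlow ad N p.1 p.2.1 p.2.2 :=
  continuous_picardIter ad N N

namespace IsNilpotentBracket

variable {ad : E →L[ℝ] E →L[ℝ] E} {C : ℕ → Submodule ℝ E} {N : ℕ} [FiniteDimensional ℝ E]

theorem picardIter_sub_mem (h : IsNilpotentBracket ad C N) (n : ℕ) (p : E × E × ℝ) :
    picardIter ad N (n + 1) p - picardIter ad N n p ∈ C n := by
  induction n generalizing p with
  | zero => simp [h.zero_eq_top]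
  | succ n ih =>
    have hc : ∀ m, Continuous fun s ↦
        expJacobianInv N (ad (picardIter ad N m (p.1, p.2.1, s))) p.2.1 := by
      intro m
      have h1 := continuous_expJacobianInv (E := E) N
      have h2 := continuous_picardIter ad N m
      fun_prop
    rw [picardIter, picardIter, add_sub_add_left_eq_sub,
      ← intervalIntegral.integral_sub ((hc _).intervalIntegrable _ _)
        ((hc _).intervalIntegrable _ _)]
    exact Submodule.intervalIntegral_mem _ ((hc _).sub (hc _))
      (fun s ↦ h.expJacobianInv_sub_mem (ih _) _) _ _

/-- The iterates `N` and `N + 1` differ by an element of `C N = ⊥`, so iterate `N` is already an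
exact fixed point, for all times. -/
theorem bchFlow_eq (h : IsNilpotentBracket ad C N) (X Y : E) (t : ℝ) :
    bchFlow ad N X Y t = X + ∫ s in (0 : ℝ)..t, expJacobianInv N (ad (bchFlow ad N X Y s)) Y := by
  have := h.picardIter_sub_mem N (X, Y, t)
  rw [h.eq_bot, Submodule.mem_bot, sub_eq_zero] at this
  exact this.symm

theorem bchFlow_zero (h : IsNilpotentBracket ad C N) (X Y : E) : bchFlow ad N X Y 0 = X := by
  rw [h.bchFlow_eq]; simp

theorem hasDerivAt_bchFlow (h : IsNilpotentBracket ad C N) (X Y : E) (t : ℝ) :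
    HasDerivAt (bchFlow ad N X Y) (expJacobianInv N (ad (bchFlow ad N X Y t)) Y) t := by
  have hc : Continuous fun s ↦ expJacobianInv N (ad (bchFlow ad N X Y s)) Y := by
    have h1 := continuous_expJacobianInv (E := E) N
    have h2 : Continuous (bchFlow ad N X Y) :=
      (continuous_bchFlow ad N).comp (by fun_prop : Continuous fun s : ℝ ↦ (X, Y, s))
    fun_prop
  have h3 : bchFlow ad N X Y =
      fun t ↦ X + ∫ s in (0 : ℝ)..t, expJacobianInv N (ad (bchFlow ad N X Y s)) Y :=
    funext (h.bchFlow_eq X Y)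
  have h4 := (intervalIntegral.integral_hasDerivAt_right (hc.intervalIntegrable 0 t)
    hc.aestronglyMeasurable.stronglyMeasurableAtFilter hc.continuousAt).const_add X
  exact h4.congr_of_eventuallyEq (Filter.Eventually.of_forall fun s ↦ h.bchFlow_eq X Y s)

end IsNilpotentBracket

end NilpotentBracket

end

noncomputable section

/-! ### A Lie group in the chart at the identity -/

section ChartAtOne

open Set Filter Topology

variable (E : Type*) [NormedAddCommGroup E] [NormedSpace ℝ E]
  (G : Type*) [TopologicalSpace G] [ChartedSpace E G] [Group G]

/-- The chart of a Lie group at the identity. -/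
abbrev oneChart : OpenPartialHomeomorph G E := chartAt E (1 : G)

/-- The identity element in the chart at the identity. -/
abbrev onePt : E := oneChart E G 1

/-- The multiplication in the chart at the identity. -/
def locMul (p : E × E) : E := oneChart E G ((oneChart E G).symm p.1 * (oneChart E G).symm p.2)

/-- The derivative at the identity of the left translations, in the chart at the identity. -/
def leftFrame (x : E) : E →L[ℝ] E := fderiv ℝ (fun y ↦ locMul E G (x, y)) (onePt E G)

omit [NormedSpace ℝ E] in
theorem one_mem_oneChart_source : (1 : G) ∈ (oneChart E G).source := mem_chart_source E 1

omit [NormedSpace ℝ E] in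
theorem onePt_mem_target : onePt E G ∈ (oneChart E G).target := mem_chart_target E 1

omit [NormedSpace ℝ E] in
theorem oneChart_symm_onePt : (oneChart E G).symm (onePt E G) = 1 :=
  (oneChart E G).left_inv (one_mem_oneChart_source E G)

omit [NormedSpace ℝ E] in
theorem locMul_onePt_right {x : E} (hx : x ∈ (oneChart E G).target) :
    locMul E G (x, onePt E G) = x := by
  rw [locMul, oneChart_symm_onePt, mul_one, (oneChart E G).right_inv hx]

omit [NormedSpace ℝ E] in
theorem locMul_onePt_left {x : E} (hx : x ∈ (oneChart E G).target) :
    locMul E G (onePt E G, x) = x := by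
  rw [locMul, oneChart_symm_onePt, one_mul, (oneChart E G).right_inv hx]

variable [LieGroup 𝓘(ℝ, E) ∞ G]

theorem contMDiffAt_oneChart {g : G} (hg : g ∈ (oneChart E G).source) :
    ContMDiffAt 𝓘(ℝ, E) 𝓘(ℝ, E) ∞ (oneChart E G) g :=
  (contMDiffOn_chart (I := 𝓘(ℝ, E)) (n := ∞) (x := (1 : G))).contMDiffAt
    ((oneChart E G).open_source.mem_nhds hg)

theorem contMDiffAt_oneChart_symm {x : E} (hx : x ∈ (oneChart E G).target) :
    ContMDiffAt 𝓘(ℝ, E) 𝓘(ℝ, E) ∞ (oneChart E G).symm x :=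
  (contMDiffOn_chart_symm (I := 𝓘(ℝ, E)) (n := ∞) (x := (1 : G))).contMDiffAt
    ((oneChart E G).open_target.mem_nhds hx)

theorem contDiffAt_locMul {p : E × E} (h1 : p.1 ∈ (oneChart E G).target)
    (h2 : p.2 ∈ (oneChart E G).target)
    (h : (oneChart E G).symm p.1 * (oneChart E G).symm p.2 ∈ (oneChart E G).source) :
    ContDiffAt ℝ ∞ (locMul E G) p := by
  rw [← contMDiffAt_iff_contDiffAt]
  have h3 : ContMDiffAt 𝓘(ℝ, E × E) 𝓘(ℝ, E) ∞ (fun p : E × E ↦ (oneChart E G).symm p.1) p :=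
    (contMDiffAt_oneChart_symm E G h1).comp p contDiff_fst.contMDiff.contMDiffAt
  have h4 : ContMDiffAt 𝓘(ℝ, E × E) 𝓘(ℝ, E) ∞ (fun p : E × E ↦ (oneChart E G).symm p.2) p :=
    (contMDiffAt_oneChart_symm E G h2).comp p contDiff_snd.contMDiff.contMDiffAt
  exact (contMDiffAt_oneChart E G h).comp p (h3.mul h4)

theorem contDiffAt_locMul_onePt {x : E} (hx : x ∈ (oneChart E G).target) :
    ContDiffAt ℝ ∞ (locMul E G) (x, onePt E G) := by
  refine contDiffAt_locMul E G hx (onePt_mem_target E G) ?_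
  simpa [oneChart_symm_onePt] using (oneChart E G).map_target hx

theorem hasFDerivAt_leftFrame {x : E} (hx : x ∈ (oneChart E G).target) :
    HasFDerivAt (fun y ↦ locMul E G (x, y)) (leftFrame E G x) (onePt E G) := by
  have h1 := ((contDiffAt_locMul_onePt E G hx).differentiableAt (by simp)).comp (onePt E G)
    ((differentiableAt_const x).prodMk differentiableAt_id)
  exact h1.hasFDerivAt

/-- As a partial derivative of the jointly smooth multiplication, the frame is seen to depend
smoothly on `x`. -/
theorem leftFrame_eq {x : E} (hx : x ∈ (oneChart E G).target) : leftFrame E G x =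
    (fderiv ℝ (locMul E G) (x, onePt E G)).comp (ContinuousLinearMap.inr ℝ E E) := by
  have h1 := ((contDiffAt_locMul_onePt E G hx).differentiableAt (by simp)).hasFDerivAt
  have h2 := HasFDerivAt.comp (onePt E G) (f := fun y : E ↦ (x, y)) h1
    (hasFDerivAt_prodMk_right x _)
  exact (hasFDerivAt_leftFrame E G hx).unique h2

theorem contDiffAt_leftFrame {x : E} (hx : x ∈ (oneChart E G).target) :
    ContDiffAt ℝ ∞ (leftFrame E G) x := by
  have h1 : ContDiffAt ℝ ∞ (fun x ↦
      (fderiv ℝ (locMul E G) (x, onePt E G)).comp (ContinuousLinearMap.inr ℝ E E)) x := by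
    have h2 := (contDiffAt_locMul_onePt E G hx).fderiv_right (m := ∞) (by simp)
    have h3 : ContDiffAt ℝ ∞ (fun x ↦ fderiv ℝ (locMul E G) (x, onePt E G)) x :=
      ContDiffAt.comp x (g := fderiv ℝ (locMul E G)) (f := fun x : E ↦ (x, onePt E G)) h2
        (by fun_prop)
    exact h3.clm_comp contDiffAt_const
  refine h1.congr_of_eventuallyEq ?_
  filter_upwards [(oneChart E G).open_target.mem_nhds hx] with y hy using leftFrame_eq E G hy

theorem leftFrame_onePt : leftFrame E G (onePt E G) = 1 := by
  have h := hasFDerivAt_leftFrame E G (onePt_mem_target E G)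
  refine h.unique ((hasFDerivAt_id (onePt E G)).congr_of_eventuallyEq ?_)
  filter_upwards [(oneChart E G).open_target.mem_nhds (onePt_mem_target E G)] with y hy
  exact locMul_onePt_left E G hy

/-- This is the derivative of `(x y) w = x (y w)` in `w` at the identity, i.e. left invariance of
the frame. -/
theorem leftFrame_locMul {x y : E} (hx : x ∈ (oneChart E G).target)
    (hy : y ∈ (oneChart E G).target)
    (h : (oneChart E G).symm x * (oneChart E G).symm y ∈ (oneChart E G).source) :
    leftFrame E G (locMul E G (x, y)) =
      (fderiv ℝ (fun y ↦ locMul E G (x, y)) y).comp (leftFrame E G y) := by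
  have hz : locMul E G (x, y) ∈ (oneChart E G).target := (oneChart E G).map_source h
  refine (hasFDerivAt_leftFrame E G hz).unique ?_
  have h1 : DifferentiableAt ℝ (fun y ↦ locMul E G (x, y)) y :=
    ((contDiffAt_locMul E G (p := (x, y)) hx hy h).differentiableAt (by simp)).comp y
      ((differentiableAt_const x).prodMk differentiableAt_id)
  have h1' : HasFDerivAt (fun y ↦ locMul E G (x, y)) (fderiv ℝ (fun y ↦ locMul E G (x, y)) y)
      (locMul E G (y, onePt E G)) := by
    rw [locMul_onePt_right E G hy]; exact h1.hasFDerivAt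
  have h2 := h1'.comp (onePt E G) (hasFDerivAt_leftFrame E G hy)
  refine h2.congr_of_eventuallyEq ?_
  have hc : ContinuousAt (fun z ↦ (oneChart E G).symm y * (oneChart E G).symm z) (onePt E G) :=
    have := topologicalGroup_of_lieGroup (G := G) 𝓘(ℝ, E) ∞
    continuousAt_const.mul ((oneChart E G).continuousAt_symm (onePt_mem_target E G))
  have hm : (oneChart E G).symm y * (oneChart E G).symm (onePt E G) ∈ (oneChart E G).source := by
    simpa [oneChart_symm_onePt] using (oneChart E G).map_target hy
  filter_upwards [hc.preimage_mem_nhds ((oneChart E G).open_source.mem_nhds hm)] with w hw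
  rw [mem_preimage] at hw
  simp only [locMul, Function.comp]
  rw [(oneChart E G).left_inv h, (oneChart E G).left_inv hw, mul_assoc]

/-- The bracket of the left-invariant vector fields, in the chart at the identity. -/
theorem leftFrame_bracket {x : E} (hx : x ∈ (oneChart E G).target) (X Y : E) :
    fderiv ℝ (leftFrame E G) x (leftFrame E G x X) Y -
      fderiv ℝ (leftFrame E G) x (leftFrame E G x Y) X =
    leftFrame E G x (fderiv ℝ (leftFrame E G) (onePt E G) X Y -
      fderiv ℝ (leftFrame E G) (onePt E G) Y X) := by
  set D := fderiv ℝ (fun y ↦ locMul E G (x, y)) with hD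
  have hmx : ContDiffAt ℝ ∞ (fun y ↦ locMul E G (x, y)) (onePt E G) :=
    (contDiffAt_locMul_onePt E G hx).comp _ (contDiffAt_const.prodMk contDiffAt_id)
  have hDd : HasFDerivAt D (fderiv ℝ D (onePt E G)) (onePt E G) :=
    ((hmx.fderiv_right (m := ∞) (by simp)).differentiableAt (by simp)).hasFDerivAt
  have hA : ∀ {x}, x ∈ (oneChart E G).target →
      HasFDerivAt (leftFrame E G) (fderiv ℝ (leftFrame E G) x) x := fun hx ↦
    ((contDiffAt_leftFrame E G hx).differentiableAt (by simp)).hasFDerivAt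
  have hsymm : IsSymmSndFDerivAt ℝ (fun y ↦ locMul E G (x, y)) (onePt E G) :=
    hmx.isSymmSndFDerivAt (by simpa using ENat.LEInfty.out)
  -- Differentiate the left invariance of the frame in `y` at the identity. The term with the second
  -- derivative of the translation by `x` is symmetric in `X` and `Y`, so it disappears on
  -- antisymmetrizing.
  have key : ∀ X Y : E, fderiv ℝ (leftFrame E G) x (leftFrame E G x X) Y =
      fderiv ℝ D (onePt E G) X Y + leftFrame E G x (fderiv ℝ (leftFrame E G) (onePt E G) X Y) := by
    intro X Y
    have h1 : HasFDerivAt (fun y ↦ leftFrame E G (locMul E G (x, y)))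
        ((fderiv ℝ (leftFrame E G) x).comp (leftFrame E G x)) (onePt E G) := by
      refine HasFDerivAt.comp (onePt E G) (g := leftFrame E G) ?_ (hasFDerivAt_leftFrame E G hx)
      rw [locMul_onePt_right E G hx]
      exact hA hx
    have h2 := hDd.clm_comp (hA (onePt_mem_target E G))
    have h3 : (fun y ↦ leftFrame E G (locMul E G (x, y))) =ᶠ[𝓝 (onePt E G)]
        fun y ↦ (D y).comp (leftFrame E G y) := by
      have := topologicalGroup_of_lieGroup (G := G) 𝓘(ℝ, E) ∞
      have hc : ContinuousAt (fun z ↦ (oneChart E G).symm x * (oneChart E G).symm z) (onePt E G) :=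
        continuousAt_const.mul ((oneChart E G).continuousAt_symm (onePt_mem_target E G))
      have hm : (oneChart E G).symm x * (oneChart E G).symm (onePt E G) ∈
          (oneChart E G).source := by
        simpa [oneChart_symm_onePt] using (oneChart E G).map_target hx
      filter_upwards [hc.preimage_mem_nhds ((oneChart E G).open_source.mem_nhds hm),
        (oneChart E G).open_target.mem_nhds (onePt_mem_target E G)] with w hw hw'
      exact leftFrame_locMul E G hx hw' hw
    have h4 := congrArg (fun T : E →L[ℝ] E →L[ℝ] E ↦ T X Y)
      (h1.unique (h2.congr_of_eventuallyEq h3))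
    have hDo : D (onePt E G) = leftFrame E G x := rfl
    simpa [leftFrame_onePt, hDo, add_comm] using h4
  rw [key, key, hsymm X Y, map_sub]
  abel

end ChartAtOne

end

/-! ### Left logarithmic derivatives and the bracket of the Lie algebra. -/

noncomputable section

section LeftDeriv

open Set Filter Topology

variable {E : Type*} [NormedAddCommGroup E] [NormedSpace ℝ E]
  {G : Type*} [TopologicalSpace G] [ChartedSpace E G] [Group G]
  {F : Type*} [NormedAddCommGroup F] [NormedSpace ℝ F]

/-- The map `γ` into the Lie group has left logarithmic derivative `L` at `x`. -/
def HasLeftFDerivAt (γ : F → G) (L : F →L[ℝ] E) (x : F) : Prop :=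
  ContinuousAt γ x ∧ HasFDerivAt (fun y ↦ oneChart E G ((γ x)⁻¹ * γ y)) L x

variable [LieGroup 𝓘(ℝ, E) ∞ G]

theorem HasLeftFDerivAt.const_mul {γ : F → G} {L : F →L[ℝ] E} {x : F}
    (h : HasLeftFDerivAt γ L x) (g : G) : HasLeftFDerivAt (fun y ↦ g * γ y) L x := by
  have := topologicalGroup_of_lieGroup (G := G) 𝓘(ℝ, E) ∞
  refine ⟨continuousAt_const.mul h.1, ?_⟩
  simpa [mul_inv_rev, mul_assoc] using h.2

omit [LieGroup 𝓘(ℝ, E) ∞ G] in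
theorem HasLeftFDerivAt.comp {F' : Type*} [NormedAddCommGroup F'] [NormedSpace ℝ F']
    {γ : F → G} {L : F →L[ℝ] E} {f : F' → F} {f' : F' →L[ℝ] F} (x : F')
    (h : HasLeftFDerivAt γ L (f x)) (hf : HasFDerivAt f f' x) :
    HasLeftFDerivAt (fun y ↦ γ (f y)) (L.comp f') x :=
  ⟨h.1.comp hf.continuousAt, HasFDerivAt.comp x (g := fun y ↦ oneChart E G ((γ (f x))⁻¹ * γ y)) h.2 hf⟩

/-- The left logarithmic derivative is the derivative in the chart at the identity, up to the
left-invariant frame. -/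
theorem HasLeftFDerivAt.hasFDerivAt {γ : F → G} {L : F →L[ℝ] E} {x : F}
    (h : HasLeftFDerivAt γ L x) (hx : γ x ∈ (oneChart E G).source) :
    HasFDerivAt (fun y ↦ oneChart E G (γ y)) ((leftFrame E G (oneChart E G (γ x))).comp L) x := by
  have := topologicalGroup_of_lieGroup (G := G) 𝓘(ℝ, E) ∞
  have h1 := hasFDerivAt_leftFrame E G ((oneChart E G).map_source hx)
  have h1' : HasFDerivAt (fun y ↦ locMul E G (oneChart E G (γ x), y))
      (leftFrame E G (oneChart E G (γ x))) (oneChart E G ((γ x)⁻¹ * γ x)) := by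
    rwa [inv_mul_cancel]
  have h2 := h1'.comp x h.2
  refine h2.congr_of_eventuallyEq ?_
  have hc : ContinuousAt (fun y ↦ (γ x)⁻¹ * γ y) x := continuousAt_const.mul h.1
  filter_upwards [hc.preimage_mem_nhds ((oneChart E G).open_source.mem_nhds
    (by simp))] with y hy
  simp only [locMul, Function.comp]
  rw [(oneChart E G).left_inv hx, (oneChart E G).left_inv hy, mul_inv_cancel_left]

theorem hasLeftFDerivAt_of_hasFDerivAt {γ : F → G} {L : F →L[ℝ] E} {x : F} (hγ : ContinuousAt γ x)
    (hx : γ x ∈ (oneChart E G).source)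
    (h : HasFDerivAt (fun y ↦ oneChart E G (γ y))
      ((leftFrame E G (oneChart E G (γ x))).comp L) x) :
    HasLeftFDerivAt γ L x := by
  have := topologicalGroup_of_lieGroup (G := G) 𝓘(ℝ, E) ∞
  refine ⟨hγ, ?_⟩
  set g := γ x with hg
  have hm : ContMDiffAt 𝓘(ℝ, E) 𝓘(ℝ, E) ∞ (fun y ↦ oneChart E G (g⁻¹ * (oneChart E G).symm y))
      (oneChart E G g) := by
    have h1 := contMDiffAt_oneChart_symm E G ((oneChart E G).map_source hx)
    have h2 : ContMDiffAt 𝓘(ℝ, E) 𝓘(ℝ, E) ∞ (oneChart E G)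
        (g⁻¹ * (oneChart E G).symm (oneChart E G g)) := by
      rw [(oneChart E G).left_inv hx, inv_mul_cancel]
      exact contMDiffAt_oneChart E G (one_mem_oneChart_source E G)
    have h3 : ContMDiffAt 𝓘(ℝ, E) 𝓘(ℝ, E) ∞ (fun y ↦ g⁻¹ * (oneChart E G).symm y)
        (oneChart E G g) := contMDiffAt_const.mul h1
    exact ContMDiffAt.comp (f := fun y ↦ g⁻¹ * (oneChart E G).symm y) _ h2 h3
  have hd : HasFDerivAt (fun y ↦ oneChart E G (g⁻¹ * (oneChart E G).symm y)) _ (oneChart E G g) :=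
    (hm.contDiffAt.differentiableAt (by simp)).hasFDerivAt
  set T := fderiv ℝ (fun y ↦ oneChart E G (g⁻¹ * (oneChart E G).symm y)) (oneChart E G g) with hT
  -- Translations by `g` and `g⁻¹` are inverse to each other, so `T` undoes the frame at `g`.
  have hinv : T.comp (leftFrame E G (oneChart E G g)) = ContinuousLinearMap.id ℝ E := by
    have h1 := hasFDerivAt_leftFrame E G ((oneChart E G).map_source hx)
    have hd' : HasFDerivAt (fun y ↦ oneChart E G (g⁻¹ * (oneChart E G).symm y)) T
        (locMul E G (oneChart E G g, onePt E G)) := by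
      rw [locMul_onePt_right E G ((oneChart E G).map_source hx)]
      exact hd
    refine (HasFDerivAt.comp (onePt E G) (f := fun y ↦ locMul E G (oneChart E G g, y))
      hd' h1).unique ((hasFDerivAt_id _).congr_of_eventuallyEq ?_)
    have hc : ContinuousAt (fun z ↦ g * (oneChart E G).symm z) (onePt E G) :=
      continuousAt_const.mul ((oneChart E G).continuousAt_symm (onePt_mem_target E G))
    filter_upwards [hc.preimage_mem_nhds ((oneChart E G).open_source.mem_nhds
      (by simpa [oneChart_symm_onePt] using hx)),
      (oneChart E G).open_target.mem_nhds (onePt_mem_target E G)] with y hy hy'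
    simp only [locMul, Function.comp, id]
    rw [(oneChart E G).left_inv hx, (oneChart E G).left_inv hy, inv_mul_cancel_left,
      (oneChart E G).right_inv hy']
  have h2 := hd.comp x h
  rw [← ContinuousLinearMap.comp_assoc, hinv, ContinuousLinearMap.id_comp] at h2
  refine h2.congr_of_eventuallyEq ?_
  filter_upwards [hγ.preimage_mem_nhds ((oneChart E G).open_source.mem_nhds hx)] with y hy
  simp only [Function.comp]
  rw [(oneChart E G).left_inv hy]

/-- The left logarithmic derivative of `γ` is the manifold derivative of `(γ x)⁻¹ * γ`. -/
theorem hasLeftFDerivAt_iff_hasMFDerivAt {γ : F → G} {L : F →L[ℝ] E} {x : F} :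
    HasLeftFDerivAt γ L x ↔
      HasMFDerivAt 𝓘(ℝ, F) 𝓘(ℝ, E) (fun y ↦ (γ x)⁻¹ * γ y) x L := by
  have := topologicalGroup_of_lieGroup (G := G) 𝓘(ℝ, E) ∞
  have h1 : ContinuousAt γ x ↔ ContinuousAt (fun y ↦ (γ x)⁻¹ * γ y) x := by
    refine ⟨fun h ↦ continuousAt_const.mul h, fun h ↦ ?_⟩
    have : γ = fun y ↦ γ x * ((γ x)⁻¹ * γ y) := by simp
    rw [this]
    exact continuousAt_const.mul h
  unfold HasLeftFDerivAt HasMFDerivAt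
  rw [h1]
  refine and_congr_right fun _ ↦ ?_
  simp only [writtenInExtChartAt, Function.comp_def, inv_mul_cancel, mfld_simps]
  exact (hasFDerivWithinAt_univ (𝕜 := ℝ) (E := F) (F := E)).symm

theorem hasMFDerivAt_mul_left (g h : G) : HasMFDerivAt 𝓘(ℝ, E) 𝓘(ℝ, E) (fun y ↦ g * y) h
    (mfderiv 𝓘(ℝ, E) 𝓘(ℝ, E) (fun y ↦ g * y) h) :=
  ((contMDiff_mul_left (I := 𝓘(ℝ, E)) (n := ∞)).contMDiffAt.mdifferentiableAt
      (by simp)).hasMFDerivAt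

theorem mfderiv_mul_left_inv (g : G) (X : E) :
    (mfderiv 𝓘(ℝ, E) 𝓘(ℝ, E) (fun y ↦ g⁻¹ * y) g : E →L[ℝ] E)
      ((mfderiv 𝓘(ℝ, E) 𝓘(ℝ, E) (fun y ↦ g * y) (1 : G) : E →L[ℝ] E) X) = X := by
  -- The base point is generalized because `g * 1` and `g` are not definitionally equal and the type
  -- of the derivative depends on the point; all tangent spaces are read as `E`.
  have h1 : ∀ p : G, p = g → HasMFDerivAt 𝓘(ℝ, E) 𝓘(ℝ, E) (fun y ↦ g⁻¹ * y) p
      (mfderiv 𝓘(ℝ, E) 𝓘(ℝ, E) (fun y ↦ g⁻¹ * y) g : E →L[ℝ] E) := by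
    rintro _ rfl
    exact hasMFDerivAt_mul_left _ _
  have h2 := (h1 (g * 1) (mul_one g)).comp (1 : G) (hasMFDerivAt_mul_left g 1)
  have h3 : HasMFDerivAt 𝓘(ℝ, E) 𝓘(ℝ, E) (fun y : G ↦ y) 1 (ContinuousLinearMap.id ℝ E) :=
    hasMFDerivAt_id 1
  have h4 : ((fun y : G ↦ g⁻¹ * y) ∘ fun y ↦ g * y) = fun y ↦ y := by
    funext y; simp
  rw [h4] at h2
  have h5 := hasMFDerivAt_unique h2 h3
  exact congrArg (fun T : E →L[ℝ] E ↦ T X) h5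

/-- Translating by `(γ t)⁻¹` turns the invariant field at `γ t` back into `X`. Integral curves of
invariant fields thus become curves of constant left logarithmic derivative, for which only the
chart at the identity is needed. -/
theorem hasMFDerivAt_iff_hasLeftFDerivAt {γ : ℝ → G} {X : E} {t : ℝ} :
    HasMFDerivAt 𝓘(ℝ, ℝ) 𝓘(ℝ, E) γ t ((1 : ℝ →L[ℝ] ℝ).smulRight
      (mulInvariantVectorField (I := 𝓘(ℝ, E)) (G := G) X (γ t))) ↔
    HasLeftFDerivAt γ ((1 : ℝ →L[ℝ] ℝ).smulRight X) t := by
  rw [hasLeftFDerivAt_iff_hasMFDerivAt]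
  constructor
  · intro h
    refine ((hasMFDerivAt_mul_left (γ t)⁻¹ (γ t)).comp t h).congr_mfderiv ?_
    refine ContinuousLinearMap.ext (R₁ := ℝ) (M₁ := ℝ) (M₂ := E) fun s ↦ ?_
    have := mfderiv_mul_left_inv (γ t) (s • X)
    have h2 := map_smul (mfderiv 𝓘(ℝ, E) 𝓘(ℝ, E) (fun y ↦ γ t * y) (1 : G) : E →L[ℝ] E) s X
    exact (congrArg (mfderiv 𝓘(ℝ, E) 𝓘(ℝ, E) (fun y ↦ (γ t)⁻¹ * y) (γ t) : E →L[ℝ] E)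
      h2).symm.trans this
  · intro h
    have h1 : ∀ p : G, p = 1 → HasMFDerivAt 𝓘(ℝ, E) 𝓘(ℝ, E) (fun y ↦ γ t * y) p
        (mfderiv 𝓘(ℝ, E) 𝓘(ℝ, E) (fun y ↦ γ t * y) (1 : G) : E →L[ℝ] E) := by
      rintro _ rfl
      exact hasMFDerivAt_mul_left _ _
    have h2 := (h1 ((γ t)⁻¹ * γ t) (inv_mul_cancel _)).comp t h
    have h4 : ((fun y : G ↦ γ t * y) ∘ fun y ↦ (γ t)⁻¹ * γ y) = γ := by
      funext y; simp
    rw [h4] at h2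
    refine h2.congr_mfderiv ?_
    refine ContinuousLinearMap.ext (R₁ := ℝ) (M₁ := ℝ) (M₂ := E) fun s ↦ ?_
    exact map_smul (mfderiv 𝓘(ℝ, E) 𝓘(ℝ, E) (fun y ↦ γ t * y) (1 : G) : E →L[ℝ] E) s X

variable (E G) in
/-- The bracket of the Lie algebra, as a bilinear map on the model space. -/
def lieBr : E →L[ℝ] E →L[ℝ] E :=
  fderiv ℝ (leftFrame E G) (onePt E G) - (fderiv ℝ (leftFrame E G) (onePt E G)).flip

variable (E G) in
omit [LieGroup 𝓘(ℝ, E) ∞ G] in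
theorem lieBr_apply (X Y : E) : lieBr E G X Y = fderiv ℝ (leftFrame E G) (onePt E G) X Y -
    fderiv ℝ (leftFrame E G) (onePt E G) Y X := by
  simp [lieBr]

variable (E G) in
omit [LieGroup 𝓘(ℝ, E) ∞ G] in
theorem hasMFDerivAt_oneChart_symm_onePt : HasMFDerivAt 𝓘(ℝ, E) 𝓘(ℝ, E)
    (extChartAt 𝓘(ℝ, E) (1 : G)).symm (onePt E G) (ContinuousLinearMap.id ℝ E) := by
  refine ⟨(oneChart E G).continuousAt_symm (onePt_mem_target E G), ?_⟩
  refine (hasFDerivWithinAt_univ (𝕜 := ℝ) (E := E) (F := E)).2 ?_ |>.mono (subset_univ _)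
  refine (hasFDerivAt_id (onePt E G)).congr_of_eventuallyEq ?_
  filter_upwards [(oneChart E G).open_target.mem_nhds (onePt_mem_target E G)] with y hy
  have h : ∀ g : G, g = 1 → extChartAt 𝓘(ℝ, E) g ((oneChart E G).symm y) = y := by
    rintro _ rfl
    simpa using (oneChart E G).right_inv hy
  exact h _ (oneChart_symm_onePt E G)

variable (E G) in
omit [LieGroup 𝓘(ℝ, E) ∞ G] in
theorem hasMFDerivAt_oneChart_one : HasMFDerivAt 𝓘(ℝ, E) 𝓘(ℝ, E)
    (extChartAt 𝓘(ℝ, E) (1 : G)) (1 : G) (ContinuousLinearMap.id ℝ E) := by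
  refine ⟨(oneChart E G).continuousAt (one_mem_oneChart_source E G), ?_⟩
  refine (hasFDerivWithinAt_univ (𝕜 := ℝ) (E := E) (F := E)).2 ?_ |>.mono (subset_univ _)
  refine (hasFDerivAt_id (onePt E G)).congr_of_eventuallyEq ?_
  filter_upwards [(oneChart E G).open_target.mem_nhds (onePt_mem_target E G)] with y hy
  exact (oneChart E G).right_inv hy

/-- Identifies the coordinate expression of an invariant field, so that the bracket of fields can be
computed with `leftFrame`. -/
theorem mpullback_mulInvariantVectorField_oneChart {x : E} (hx : x ∈ (oneChart E G).target)
    (X : E) :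
    VectorField.mpullbackWithin 𝓘(ℝ, E) 𝓘(ℝ, E) (extChartAt 𝓘(ℝ, E) (1 : G)).symm
      (mulInvariantVectorField (I := 𝓘(ℝ, E)) (G := G) X) (range 𝓘(ℝ, E)) x =
    leftFrame E G x X := by
  have := topologicalGroup_of_lieGroup (G := G) 𝓘(ℝ, E) ∞
  have : IsManifold 𝓘(ℝ, E) ∞ G := inferInstance
  have : IsManifold 𝓘(ℝ, E) 1 G := IsManifold.of_le (n := ∞) (by simp)
  set φ : E → G := ⇑(extChartAt 𝓘(ℝ, E) (1 : G)).symm with hφ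
  have hφ' : φ = (oneChart E G).symm := by
    funext y; simp [hφ]
  have hxe : x ∈ (extChartAt 𝓘(ℝ, E) (1 : G)).target := by simpa using hx
  have hinv := isInvertible_mfderivWithin_extChartAt_symm (I := 𝓘(ℝ, E)) hxe
  rw [VectorField.mpullbackWithin_apply]
  refine hinv.inverse_apply_eq.2 ?_
  have hr : range (𝓘(ℝ, E)) = univ := by simp
  rw [hr, mfderivWithin_univ]
  -- both sides are the derivative of `y ↦ φ x * φ y` at the identity
  have hM : HasMFDerivAt 𝓘(ℝ, E) 𝓘(ℝ, E) φ (locMul E G (x, onePt E G))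
      (mfderiv 𝓘(ℝ, E) 𝓘(ℝ, E) φ x : E →L[ℝ] E) := by
    rw [locMul_onePt_right E G hx, hφ']
    exact ((contMDiffAt_oneChart_symm E G hx).mdifferentiableAt (by simp)).hasMFDerivAt
  have h1 := hM.comp (onePt E G) (hasFDerivAt_leftFrame E G hx).hasMFDerivAt
  have h2 : ∀ g : G, g = 1 → HasMFDerivAt 𝓘(ℝ, E) 𝓘(ℝ, E) (fun y ↦ φ x * y) g
      (mfderiv 𝓘(ℝ, E) 𝓘(ℝ, E) (fun y ↦ φ x * y) (1 : G) : E →L[ℝ] E) := by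
    rintro _ rfl
    exact hasMFDerivAt_mul_left _ _
  have h3 := (h2 (φ (onePt E G)) (by rw [hφ']; exact oneChart_symm_onePt E G)).comp (onePt E G)
    (hasMFDerivAt_oneChart_symm_onePt E G)
  have hc : ContinuousAt (fun z ↦ (oneChart E G).symm x * (oneChart E G).symm z) (onePt E G) :=
    continuousAt_const.mul ((oneChart E G).continuousAt_symm (onePt_mem_target E G))
  have hm : (oneChart E G).symm x * (oneChart E G).symm (onePt E G) ∈ (oneChart E G).source := by
    simpa [oneChart_symm_onePt] using (oneChart E G).map_target hx
  have h4 : (φ ∘ fun y ↦ locMul E G (x, y)) =ᶠ[𝓝 (onePt E G)] ((fun y ↦ φ x * y) ∘ φ) := by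
    filter_upwards [hc.preimage_mem_nhds ((oneChart E G).open_source.mem_nhds hm)] with y hy
    simp only [Function.comp, locMul, hφ']
    rw [(oneChart E G).left_inv hy]
  have h5 := hasMFDerivAt_unique (h1.congr_of_eventuallyEq h4.symm) h3
  exact (congrArg (fun T : E →L[ℝ] E ↦ T X) h5).symm

/-- The bracket is that of the invariant fields, evaluated at the identity in the chart there; the
frame is the identity at that point and so is the derivative of the chart, hence only the derivative
of the frame survives. -/
theorem bracket_eq_lieBr (X Y : GroupLieAlgebra 𝓘(ℝ, E) G) :
    ⁅X, Y⁆ = lieBr E G X Y := by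
  set V' : E → E := VectorField.mpullbackWithin 𝓘(ℝ, E) 𝓘(ℝ, E) (extChartAt 𝓘(ℝ, E) (1 : G)).symm
      (mulInvariantVectorField (I := 𝓘(ℝ, E)) (G := G) X) (range 𝓘(ℝ, E)) with hV
  set W' : E → E := VectorField.mpullbackWithin 𝓘(ℝ, E) 𝓘(ℝ, E) (extChartAt 𝓘(ℝ, E) (1 : G)).symm
      (mulInvariantVectorField (I := 𝓘(ℝ, E)) (G := G) Y) (range 𝓘(ℝ, E)) with hW
  have h0 : ⁅X, Y⁆ = (mfderiv 𝓘(ℝ, E) 𝓘(ℝ, E) (extChartAt 𝓘(ℝ, E) (1 : G)) 1 : E →L[ℝ] E).inverse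
      (VectorField.lieBracketWithin (E := E) ℝ V' W'
        ((extChartAt 𝓘(ℝ, E) (1 : G)).symm ⁻¹' univ ∩ range 𝓘(ℝ, E))
        (extChartAt 𝓘(ℝ, E) (1 : G) 1)) := rfl
  have h1 : (mfderiv 𝓘(ℝ, E) 𝓘(ℝ, E) (extChartAt 𝓘(ℝ, E) (1 : G)) 1 : E →L[ℝ] E) =
      ContinuousLinearMap.id ℝ E := (hasMFDerivAt_oneChart_one E G).mfderiv
  have hs : ((extChartAt 𝓘(ℝ, E) (1 : G)).symm ⁻¹' univ ∩ range 𝓘(ℝ, E)) = univ := by simp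
  have hp : extChartAt 𝓘(ℝ, E) (1 : G) 1 = onePt E G := by simp
  have hev : ∀ Z : E, (VectorField.mpullbackWithin 𝓘(ℝ, E) 𝓘(ℝ, E)
      (extChartAt 𝓘(ℝ, E) (1 : G)).symm
      (mulInvariantVectorField (I := 𝓘(ℝ, E)) (G := G) Z) (range 𝓘(ℝ, E)) : E → E)
      =ᶠ[𝓝 (onePt E G)] fun x ↦ leftFrame E G x Z := by
    intro Z
    filter_upwards [(oneChart E G).open_target.mem_nhds (onePt_mem_target E G)] with y hy
    exact mpullback_mulInvariantVectorField_oneChart hy Z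
  have hd : ∀ Z : E, fderiv ℝ (fun x ↦ leftFrame E G x Z) (onePt E G) =
      (fderiv ℝ (leftFrame E G) (onePt E G)).flip Z := by
    intro Z
    have := ((contDiffAt_leftFrame E G (onePt_mem_target E G)).differentiableAt
      (by simp)).hasFDerivAt.clm_apply (hasFDerivAt_const Z (onePt E G))
    rw [this.fderiv]
    ext; simp
  have h2 : ∀ (V W : E → E) (X Y : E), (V =ᶠ[𝓝 (onePt E G)] fun x ↦ leftFrame E G x X) →
      (W =ᶠ[𝓝 (onePt E G)] fun x ↦ leftFrame E G x Y) →
      VectorField.lieBracketWithin ℝ V W univ (onePt E G) = lieBr E G X Y := by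
    intro V W X Y hV hW
    rw [VectorField.lieBracketWithin_eq]
    simp only [fderivWithin_univ]
    rw [hV.fderiv_eq, hW.fderiv_eq, hd, hd, hV.self_of_nhds, hW.self_of_nhds, lieBr_apply]
    simp [leftFrame_onePt]
  rw [h0, hs, hp]
  refine Eq.trans ?_ (h2 V' W' X Y (hev X) (hev Y))
  have h3 : (ContinuousLinearMap.id ℝ E).inverse = ContinuousLinearMap.id ℝ E := by simp
  exact congrArg (fun T : E →L[ℝ] E ↦ T _) ((congrArg ContinuousLinearMap.inverse h1).trans h3)

end LeftDeriv

end

/-! ### One-parameter subgroups and the exponential map. -/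

noncomputable section

section Exponential

open Set Filter Topology

variable {E : Type*} [NormedAddCommGroup E] [NormedSpace ℝ E]
  {G : Type*} [TopologicalSpace G] [ChartedSpace E G] [Group G] [LieGroup 𝓘(ℝ, E) ∞ G]

variable (E G) in
theorem isManifold_one_of_lieGroup : IsManifold 𝓘(ℝ, E) 1 G :=
  have : IsManifold 𝓘(ℝ, E) ∞ G := inferInstance
  IsManifold.of_le (n := ∞) (by simp)

theorem contMDiff_one_mulInvariantVectorField (X : GroupLieAlgebra 𝓘(ℝ, E) G) :
    ContMDiff 𝓘(ℝ, E) 𝓘(ℝ, E).tangent 1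
      (fun g : G ↦ (mulInvariantVectorField (I := 𝓘(ℝ, E)) X g : TangentBundle 𝓘(ℝ, E) G)) :=
  (contMDiff_mulInvariantVectorField (I := 𝓘(ℝ, E)) X).of_le (by simp)

theorem isMIntegralCurve_iff {γ : ℝ → G} {X : E} :
    IsMIntegralCurve (I := 𝓘(ℝ, E)) γ (mulInvariantVectorField (I := 𝓘(ℝ, E)) (G := G) X) ↔
      ∀ t, HasLeftFDerivAt γ ((1 : ℝ →L[ℝ] ℝ).smulRight X) t :=
  forall_congr' fun _ ↦ hasMFDerivAt_iff_hasLeftFDerivAt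

theorem isMIntegralCurveOn_iff {γ : ℝ → G} {X : E} {s : Set ℝ} (hs : IsOpen s) :
    IsMIntegralCurveOn (I := 𝓘(ℝ, E)) γ (mulInvariantVectorField (I := 𝓘(ℝ, E)) (G := G) X) s ↔
      ∀ t ∈ s, HasLeftFDerivAt γ ((1 : ℝ →L[ℝ] ℝ).smulRight X) t := by
  rw [isMIntegralCurveOn_iff_isMIntegralCurveAt hs]
  constructor
  · intro h t ht
    exact hasMFDerivAt_iff_hasLeftFDerivAt.1 (h t ht).self_of_nhds
  · intro h t ht
    filter_upwards [hs.mem_nhds ht] with u hu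
    exact hasMFDerivAt_iff_hasLeftFDerivAt.2 (h u hu)

variable [CompleteSpace E] [T2Space G]

/-- Invariant fields are complete: left translates of one short integral curve at the identity give
the same existence time at every point. -/
theorem exists_hasLeftFDerivAt (X : E) : ∃ γ : ℝ → G, γ 0 = 1 ∧
    ∀ t, HasLeftFDerivAt γ ((1 : ℝ →L[ℝ] ℝ).smulRight X) t := by
  have := isManifold_one_of_lieGroup E G
  obtain ⟨γ, h0, hγ⟩ := exists_isMIntegralCurveAt_of_contMDiffAt_boundaryless (I := 𝓘(ℝ, E))
    (x₀ := (1 : G)) 0 (contMDiff_one_mulInvariantVectorField (E := E) (G := G) X).contMDiffAt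
  rw [isMIntegralCurveAt_iff'] at hγ
  obtain ⟨ε, hε, hγ⟩ := hγ
  rw [Real.ball_eq_Ioo, zero_sub, zero_add, isMIntegralCurveOn_iff isOpen_Ioo] at hγ
  obtain ⟨γ', h1, h2⟩ := exists_isMIntegralCurve_of_isMIntegralCurveOn (I := 𝓘(ℝ, E))
    (contMDiff_one_mulInvariantVectorField (E := E) (G := G) X) hε (fun g ↦ ⟨fun t ↦ g * γ t,
      by simp [h0], (isMIntegralCurveOn_iff isOpen_Ioo).2 fun t ht ↦ (hγ t ht).const_mul g⟩) 1
  exact ⟨γ', h1, isMIntegralCurve_iff.1 h2⟩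

theorem lieExp_spec (X : E) : ∃ γ : ℝ → G, γ 0 = 1 ∧
    (∀ t, HasLeftFDerivAt γ ((1 : ℝ →L[ℝ] ℝ).smulRight X) t) ∧
    lieExp (E := E) (G := G) X = γ 1 := by
  have h : ∃ γ : ℝ → G, γ 0 = 1 ∧ IsMIntegralCurve (I := 𝓘(ℝ, E)) γ
      (mulInvariantVectorField (I := 𝓘(ℝ, E)) (G := G) X) := by
    obtain ⟨γ, h0, h1⟩ := exists_hasLeftFDerivAt (E := E) (G := G) X
    exact ⟨γ, h0, isMIntegralCurve_iff.2 h1⟩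
  refine ⟨h.choose, h.choose_spec.1, isMIntegralCurve_iff.1 h.choose_spec.2, ?_⟩
  exact dif_pos h

omit [CompleteSpace E] in
theorem eq_of_hasLeftFDerivAt {γ γ' : ℝ → G} {X : E}
    (h : ∀ t, HasLeftFDerivAt γ ((1 : ℝ →L[ℝ] ℝ).smulRight X) t)
    (h' : ∀ t, HasLeftFDerivAt γ' ((1 : ℝ →L[ℝ] ℝ).smulRight X) t) (h0 : γ 0 = γ' 0) : γ = γ' :=
  have := isManifold_one_of_lieGroup E G
  isMIntegralCurve_Ioo_eq_of_contMDiff_boundaryless (I := 𝓘(ℝ, E)) (t₀ := 0)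
    (contMDiff_one_mulInvariantVectorField (E := E) (G := G) X) (isMIntegralCurve_iff.2 h)
    (isMIntegralCurve_iff.2 h') h0

omit [CompleteSpace E] in
theorem eqOn_of_hasLeftFDerivAt {γ γ' : ℝ → G} {X : E} {a b : ℝ} (hab : 0 ∈ Ioo a b)
    (h : ∀ t ∈ Ioo a b, HasLeftFDerivAt γ ((1 : ℝ →L[ℝ] ℝ).smulRight X) t)
    (h' : ∀ t ∈ Ioo a b, HasLeftFDerivAt γ' ((1 : ℝ →L[ℝ] ℝ).smulRight X) t)
    (h0 : γ 0 = γ' 0) : EqOn γ γ' (Ioo a b) :=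
  have := isManifold_one_of_lieGroup E G
  isMIntegralCurveOn_Ioo_eqOn_of_contMDiff_boundaryless (I := 𝓘(ℝ, E)) hab
    (contMDiff_one_mulInvariantVectorField (E := E) (G := G) X)
    ((isMIntegralCurveOn_iff isOpen_Ioo).2 h) ((isMIntegralCurveOn_iff isOpen_Ioo).2 h') h0

/-- The exponential map, defined on the model space. -/
abbrev gexp (X : E) : G := lieExp (E := E) (G := G) X

omit [CompleteSpace E] [T2Space G] in
omit [LieGroup 𝓘(ℝ, E) ∞ G] in
theorem HasLeftFDerivAt.comp_mul {γ : ℝ → G} {X : E} {s t : ℝ}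
    (h : HasLeftFDerivAt γ ((1 : ℝ →L[ℝ] ℝ).smulRight X) (s * t)) :
    HasLeftFDerivAt (fun t ↦ γ (s * t)) ((1 : ℝ →L[ℝ] ℝ).smulRight (s • X)) t := by
  have h1 : HasFDerivAt (fun t : ℝ ↦ s * t) (s • (1 : ℝ →L[ℝ] ℝ)) t :=
    (hasFDerivAt_id t).const_mul s
  have h2 := HasLeftFDerivAt.comp (f := fun t ↦ s * t) t h h1
  convert h2 using 1
  ext
  simp

theorem gexp_smul_of_hasLeftFDerivAt {γ : ℝ → G} {X : E} (h0 : γ 0 = 1)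
    (h : ∀ t, HasLeftFDerivAt γ ((1 : ℝ →L[ℝ] ℝ).smulRight X) t) (t : ℝ) :
    gexp (t • X) = γ t := by
  obtain ⟨γ', h0', h', he⟩ := lieExp_spec (E := E) (G := G) (t • X)
  have h2 := eq_of_hasLeftFDerivAt h' (fun s ↦ (h (t * s)).comp_mul) (by simp [h0, h0'])
  rw [gexp, he, h2]
  simp

theorem hasLeftFDerivAt_gexp_smul (g : G) (X : E) (t : ℝ) :
    HasLeftFDerivAt (fun t : ℝ ↦ g * gexp (t • X)) ((1 : ℝ →L[ℝ] ℝ).smulRight X) t := by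
  obtain ⟨γ, h0, h1⟩ := exists_hasLeftFDerivAt (E := E) (G := G) X
  have h2 : (fun t : ℝ ↦ g * gexp (t • X)) = fun t ↦ g * γ t := by
    funext t; rw [gexp_smul_of_hasLeftFDerivAt h0 h1]
  rw [h2]
  exact (h1 t).const_mul g

theorem gexp_zero : gexp (0 : E) = (1 : G) := by
  obtain ⟨γ, h0, h1⟩ := exists_hasLeftFDerivAt (E := E) (G := G) 0
  rw [← zero_smul ℝ (0 : E), gexp_smul_of_hasLeftFDerivAt h0 h1, h0]

/-- Uniqueness of integral curves. It gives both the one-parameter group law and, later, the product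
formula `gexp_bchFlow`. -/
theorem eq_mul_gexp_smul {γ : ℝ → G} {X : E}
    (h : ∀ t, HasLeftFDerivAt γ ((1 : ℝ →L[ℝ] ℝ).smulRight X) t) (t : ℝ) :
    γ t = γ 0 * gexp (t • X) :=
  congrFun (eq_of_hasLeftFDerivAt h (hasLeftFDerivAt_gexp_smul (γ 0) X) (by simp [gexp_zero])) t

omit [CompleteSpace E] [T2Space G] in
omit [LieGroup 𝓘(ℝ, E) ∞ G] in
theorem HasLeftFDerivAt.comp_add {γ : ℝ → G} {X : E} {s t : ℝ}
    (h : HasLeftFDerivAt γ ((1 : ℝ →L[ℝ] ℝ).smulRight X) (s + t)) :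
    HasLeftFDerivAt (fun t ↦ γ (s + t)) ((1 : ℝ →L[ℝ] ℝ).smulRight X) t := by
  have h1 : HasFDerivAt (fun t : ℝ ↦ s + t) (ContinuousLinearMap.id ℝ ℝ) t :=
    (hasFDerivAt_id t).const_add s
  exact HasLeftFDerivAt.comp (f := fun t ↦ s + t) t h h1

theorem gexp_add_smul (s t : ℝ) (X : E) :
    gexp ((s + t) • X) = (gexp (s • X) * gexp (t • X) : G) := by
  have h := eq_mul_gexp_smul (γ := fun t ↦ (gexp ((s + t) • X) : G)) (X := X) (fun t ↦ by
    have := hasLeftFDerivAt_gexp_smul (1 : G) X (s + t)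
    simp only [one_mul] at this
    exact this.comp_add) t
  simpa using h

theorem gexp_neg (X : E) : gexp (-X) = (gexp X : G)⁻¹ := by
  have h := gexp_add_smul (G := G) 1 (-1) X
  rw [eq_inv_iff_mul_eq_one, ← gexp_zero (E := E)]
  have h' := gexp_add_smul (G := G) (-1) 1 X
  simpa using h'.symm

end Exponential

end

noncomputable section

/-! ### Differentiable dependence on parameters for equations `x' = A(x) p` -/

section ParametricODE

open Set Filter Topology Metric

variable {E : Type*} [NormedAddCommGroup E] [NormedSpace ℝ E]
  {F : Type*} [NormedAddCommGroup F] [NormedSpace ℝ F]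

/-- Bounds for a map and for its Taylor expansions of order 0 and 1 on a ball. -/
structure TaylorBounds (A : E → F) (a : E) (ρ K : ℝ) : Prop where
  norm_le : ∀ x ∈ closedBall a ρ, ‖A x‖ ≤ K
  norm_fderiv_le : ∀ x ∈ closedBall a ρ, ‖fderiv ℝ A x‖ ≤ K
  norm_sub_le : ∀ x ∈ closedBall a ρ, ∀ y ∈ closedBall a ρ, ‖A y - A x‖ ≤ K * ‖y - x‖
  norm_taylor_le : ∀ x ∈ closedBall a ρ, ∀ y ∈ closedBall a ρ,
    ‖A y - A x - fderiv ℝ A x (y - x)‖ ≤ K * ‖y - x‖ ^ 2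

theorem exists_taylorBounds {A : E → F} {a : E} (hA : ContDiffAt ℝ ∞ A a) {s : Set E}
    (hs : s ∈ 𝓝 a) : ∃ ρ > 0, ∃ K ≥ 0, closedBall a ρ ⊆ s ∧ TaylorBounds A a ρ K := by
  have h2 : ContDiffAt ℝ 2 A a := hA.of_le ENat.LEInfty.out
  have h1 : ContDiffAt ℝ 1 (fderiv ℝ A) a := h2.fderiv_right (by norm_num)
  obtain ⟨K, t, ht, hK⟩ := h1.exists_lipschitzOnWith
  have hd : ∀ᶠ x in 𝓝 a, DifferentiableAt ℝ A x := by
    filter_upwards [h2.eventually (by simp)] with x hx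
    exact hx.differentiableAt (by simp)
  have hb1 : ∀ᶠ x in 𝓝 a, ‖A x‖ < ‖A a‖ + 1 :=
    h2.continuousAt.norm.eventually_lt continuousAt_const (by simp)
  have hb2 : ∀ᶠ x in 𝓝 a, ‖fderiv ℝ A x‖ < ‖fderiv ℝ A a‖ + 1 :=
    h1.continuousAt.norm.eventually_lt continuousAt_const (by simp)
  obtain ⟨ρ, hρ, hball⟩ := nhds_basis_closedBall.mem_iff.1
    (inter_mem hs (inter_mem ht (inter_mem hd (inter_mem hb1 hb2))))
  set M := max (K : ℝ) (max (‖A a‖ + 1) (‖fderiv ℝ A a‖ + 1)) with hM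
  have hM1 : (K : ℝ) ≤ M := le_max_left _ _
  have hM2 : ‖A a‖ + 1 ≤ M := (le_max_left _ _).trans (le_max_right _ _)
  have hM3 : ‖fderiv ℝ A a‖ + 1 ≤ M := (le_max_right _ _).trans (le_max_right _ _)
  refine ⟨ρ, hρ, M, K.2.trans hM1, fun x hx ↦ (hball hx).1, ?_, ?_, ?_, ?_⟩
  · exact fun x hx ↦ (hball hx).2.2.2.1.le.trans hM2
  · exact fun x hx ↦ (hball hx).2.2.2.2.le.trans hM3
  · intro x hx y hy
    refine (convex_closedBall a ρ).norm_image_sub_le_of_norm_fderiv_le (𝕜 := ℝ)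
      (fun z hz ↦ (hball hz).2.2.1) (fun z hz ↦ (hball hz).2.2.2.2.le.trans hM3) hx hy
  · intro x hx y hy
    have hseg : segment ℝ x y ⊆ closedBall a ρ := (convex_closedBall a ρ).segment_subset hx hy
    have := (convex_segment x y).norm_image_sub_le_of_norm_hasFDerivWithin_le' (𝕜 := ℝ) (f := A)
      (f' := fderiv ℝ A) (φ := fderiv ℝ A x) (C := K * ‖y - x‖)
      (fun z hz ↦ (hball (hseg hz)).2.2.1.hasFDerivAt.hasFDerivWithinAt) (fun z hz ↦ ?_)
      (left_mem_segment ℝ x y) (right_mem_segment ℝ x y)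
    · refine this.trans ?_
      rw [mul_assoc, ← pow_two]
      gcongr
    · refine (hK.norm_sub_le (hball (hseg hz)).2.1 (hball hx).2.1).trans ?_
      gcongr
      exact norm_sub_le_of_mem_segment hz

/-- The solution is a fixed point in a space of curves confined to the ball; the confinement is
recorded because the bounds on `A` hold only there. -/
theorem IsPicardLindelof.exists_mem_closedBall [CompleteSpace E] {f : ℝ → E → E} {tmin tmax : ℝ}
    {t₀ : Icc tmin tmax} {x₀ x : E} {a r L K : NNReal}
    (hf : IsPicardLindelof f t₀ x₀ a r L K) (hx : x ∈ closedBall x₀ r) :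
    ∃ α : ℝ → E, α t₀ = x ∧ (∀ t ∈ Icc tmin tmax, α t ∈ closedBall x₀ a) ∧
      ∀ t ∈ Icc tmin tmax, HasDerivWithinAt α (f t (α t)) (Icc tmin tmax) t := by
  obtain ⟨α, hα⟩ := ODE.FunSpace.exists_isFixedPt_next hf hx
  refine ⟨α.compProj, by rw [ODE.FunSpace.compProj_val, ← hα, ODE.FunSpace.next_apply₀],
    fun t _ ↦ α.compProj_mem_closedBall hf.mul_max_le, fun t ht ↦ ?_⟩
  apply ODE.hasDerivWithinAt_picard_Icc t₀.2 hf.continuousOn_uncurry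
    α.continuous_compProj.continuousOn (fun _ ht' ↦ α.compProj_mem_closedBall hf.mul_max_le)
    x ht |>.congr_of_mem _ ht
  intro t' ht'
  nth_rw 1 [← hα]
  rw [ODE.FunSpace.compProj_of_mem ht', ODE.FunSpace.next_apply]

theorem TaylorBounds.exists_solution [CompleteSpace E] {A : E → F →L[ℝ] E} {a : E} {ρ K : ℝ}
    (hρ : 0 < ρ) (hK : 0 ≤ K) (h : TaylorBounds A a ρ K) (R : ℝ) (hR : 0 ≤ R) :
    ∃ δ > 0, ∀ p : F, ‖p‖ ≤ R → ∀ y ∈ closedBall a (ρ / 2), ∃ α : ℝ → E, α 0 = y ∧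
      ∀ s ∈ Icc (-δ) δ, α s ∈ closedBall a ρ ∧
        HasDerivWithinAt α (A (α s) p) (Icc (-δ) δ) s := by
  have hKR : 0 ≤ K * R := by positivity
  -- The speed is at most `K * R`, and a start in the half ball leaves a distance `ρ / 2` to cover;
  -- the summand 1 avoids a zero denominator. This time depends neither on `p` nor on `y`.
  refine ⟨ρ / 2 / (K * R + 1), by positivity, fun p hp y hy ↦ ?_⟩
  set δ := ρ / 2 / (K * R + 1) with hδ
  have hδ0 : 0 < δ := by positivity
  have hpl : IsPicardLindelof (fun _ x ↦ A x p) (tmin := -δ) (tmax := δ)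
      ⟨0, by constructor <;> linarith⟩ a ⟨ρ, hρ.le⟩ ⟨ρ / 2, by positivity⟩ ⟨K * R, hKR⟩
      ⟨K * R, hKR⟩ := by
    refine IsPicardLindelof.of_time_independent ?_ ?_ ?_
    · intro x hx
      refine ((A x).le_opNorm p).trans ?_
      exact mul_le_mul (h.norm_le x hx) hp (norm_nonneg _) hK
    · refine LipschitzOnWith.of_dist_le_mul fun x hx y hy ↦ ?_
      rw [dist_eq_norm, dist_eq_norm, ← sub_apply]
      refine ((A x - A y).le_opNorm p).trans ?_
      refine (mul_le_mul (h.norm_sub_le y hy x hx) hp (norm_nonneg _) (by positivity)).trans ?_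
      change K * ‖x - y‖ * R ≤ K * R * ‖x - y‖
      exact le_of_eq (by ring)
    · simp only [sub_zero, zero_sub, neg_neg, max_self]
      change K * R * δ ≤ ρ - ρ / 2
      rw [hδ, mul_div_assoc', div_le_iff₀ (by positivity)]
      nlinarith
  obtain ⟨α, h0, h1, h2⟩ := hpl.exists_mem_closedBall hy
  exact ⟨α, h0, fun s hs ↦ ⟨h1 s hs, h2 s hs⟩⟩

theorem gronwallBound_le {δ K ε x T : ℝ} (hδ : 0 ≤ δ) (hε : 0 ≤ ε) (hK : 1 ≤ K) 
    (hxT : x ≤ T) : gronwallBound δ K ε x ≤ (δ + ε) * Real.exp (K * T) := by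
  rw [gronwallBound_of_K_ne_0 (by positivity)]
  have h1 : Real.exp (K * x) ≤ Real.exp (K * T) := Real.exp_le_exp.2 (by gcongr)
  have h2 : ε / K ≤ ε := div_le_self hε hK
  have h3 : ε / K * (Real.exp (K * x) - 1) ≤ ε / K * Real.exp (K * x) := by
    gcongr; linarith
  have h4 : ε / K * Real.exp (K * x) ≤ ε * Real.exp (K * T) := by gcongr
  have h5 : δ * Real.exp (K * x) ≤ δ * Real.exp (K * T) := by gcongr
  simp only
  linarith

theorem norm_le_of_hasDerivWithinAt_Icc {f f' : ℝ → E} {δ K ε T : ℝ} (hK : 1 ≤ K) (hε : 0 ≤ ε)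
    (hf : ∀ s ∈ Icc 0 T, HasDerivWithinAt f (f' s) (Icc 0 T) s) (h0 : ‖f 0‖ ≤ δ)
    (bound : ∀ s ∈ Icc 0 T, ‖f' s‖ ≤ K * ‖f s‖ + ε) :
    ∀ s ∈ Icc 0 T, ‖f s‖ ≤ (δ + ε) * Real.exp (K * T) := by
  intro s hs
  refine (norm_le_gronwallBound_of_norm_deriv_right_le (a := 0) (b := T)
    (fun s hs ↦ (hf s hs).continuousWithinAt)
    (fun s hs ↦ (hf s (Ico_subset_Icc_self hs)).mono_of_mem_nhdsWithin (Icc_mem_nhdsGE_of_mem hs))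
    h0 (fun s hs ↦ bound s (Ico_subset_Icc_self hs)) s hs).trans ?_
  exact gronwallBound_le ((norm_nonneg _).trans h0) hε hK (by simpa using hs.2)

/-- Differentiability of the solutions of `x' = A(x) p` with respect to the parameter: the
derivative is the solution of the linearized equation. -/
theorem TaylorBounds.hasFDerivAt_solution {A : E → F →L[ℝ] E} {a : E} {ρ K T : ℝ} (hK : 0 ≤ K)
    (hA : TaylorBounds A a ρ K) {p₀ : F} {x : F → ℝ → E} {D : ℝ → F →L[ℝ] E} (hT : 0 ≤ T)
    (hx : ∀ᶠ p in 𝓝 p₀, ∀ s ∈ Icc 0 T, x p s ∈ closedBall a ρ ∧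
      HasDerivWithinAt (x p) (A (x p s) p) (Icc 0 T) s)
    (hD : ∀ s ∈ Icc 0 T, ∀ q, HasDerivWithinAt (fun s ↦ D s q)
      (fderiv ℝ A (x p₀ s) (D s q) p₀ + A (x p₀ s) q) (Icc 0 T) s)
    (h0 : HasFDerivAt (fun p ↦ x p 0) (D 0) p₀) {s : ℝ} (hs : s ∈ Icc 0 T) :
    HasFDerivAt (fun p ↦ x p s) (D s) p₀ := by
  obtain ⟨c, hc0, hc⟩ := h0.isBigO_sub.exists_nonneg
  rw [Asymptotics.isBigOWith_iff] at hc
  set R := ‖p₀‖ + 1 with hR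
  have hR1 : 1 ≤ R := by simp [hR]
  -- The summand 1 ensures `1 ≤ L`, as the simplified Gronwall bound requires.
  set L := K * R + 1 with hL
  have hL1 : 1 ≤ L := by
    have : 0 ≤ K * R := by positivity
    linarith
  have hp₀ := hx.self_of_nhds
  have hev : ∀ᶠ p in 𝓝 p₀, ‖p‖ ≤ R := by
    filter_upwards [continuous_norm.continuousAt.eventually_lt continuousAt_const
      (by simp [hR] : ‖p₀‖ < R)] with p hp using hp.le
  set C₁ := (c + K) * Real.exp (L * T) with hC₁
  have hC₁0 : 0 ≤ C₁ := by positivity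
  -- First Gronwall argument: Lipschitz dependence on the parameter.
  have hu : ∀ᶠ p in 𝓝 p₀, ∀ s ∈ Icc 0 T, ‖x p s - x p₀ s‖ ≤ C₁ * ‖p - p₀‖ := by
    filter_upwards [hev, hx, hc] with p hpR hpx hpc s hs
    have := norm_le_of_hasDerivWithinAt_Icc (f := fun s ↦ x p s - x p₀ s) (δ := c * ‖p - p₀‖)
      (K := L) (ε := K * ‖p - p₀‖) (T := T) hL1 (by positivity)
      (fun s hs ↦ (hpx s hs).2.sub (hp₀ s hs).2) hpc (fun s hs ↦ ?_) s hs
    · refine this.trans (le_of_eq ?_)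
      rw [hC₁]; ring
    · have e1 : A (x p s) p - A (x p₀ s) p₀ = (A (x p s) - A (x p₀ s)) p + A (x p₀ s) (p - p₀) := by
        simp
      rw [e1]
      refine (norm_add_le _ _).trans (add_le_add ?_ ?_)
      · refine ((A (x p s) - A (x p₀ s)).le_opNorm p).trans ?_
        have := hA.norm_sub_le _ (hp₀ s hs).1 _ (hpx s hs).1
        calc _ ≤ (K * ‖x p s - x p₀ s‖) * R := by gcongr
          _ ≤ L * ‖x p s - x p₀ s‖ := by
            rw [hL]; nlinarith [norm_nonneg (x p s - x p₀ s)]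
      · refine ((A (x p₀ s)).le_opNorm _).trans ?_
        gcongr
        exact hA.norm_le _ (hp₀ s hs).1
  set C₂ := K * C₁ ^ 2 * R + K * C₁ with hC₂
  have hC₂0 : 0 ≤ C₂ := by positivity
  -- Second Gronwall argument, for the remainder: by the Lipschitz estimate just obtained, the
  -- Taylor error of `A` and the mixed term are both quadratic in `p - p₀`.
  have hw : ∀ᶠ p in 𝓝 p₀, ‖x p s - x p₀ s - D s (p - p₀)‖ ≤
      (‖x p 0 - x p₀ 0 - D 0 (p - p₀)‖ + C₂ * ‖p - p₀‖ ^ 2) * Real.exp (L * T) := by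
    filter_upwards [hev, hx, hu] with p hpR hpx hpu
    refine norm_le_of_hasDerivWithinAt_Icc (f := fun s ↦ x p s - x p₀ s - D s (p - p₀))
      (K := L) (T := T) hL1 (by positivity)
      (fun s hs ↦ ((hpx s hs).2.sub (hp₀ s hs).2).sub (hD s hs (p - p₀))) le_rfl
      (fun s hs ↦ ?_) s hs
    set u := x p s - x p₀ s with hu'
    set q := p - p₀ with hq
    set B := fderiv ℝ A (x p₀ s) with hB
    have e1 : A (x p s) p - A (x p₀ s) p₀ - (B (D s q) p₀ + A (x p₀ s) q) =
        B (u - D s q) p₀ + ((A (x p s) - A (x p₀ s) - B u) p₀ + (A (x p s) - A (x p₀ s)) q) := by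
      simp [hq]; abel
    rw [e1]
    have hu1 : ‖u‖ ≤ C₁ * ‖q‖ := hpu s hs
    have hb1 : ‖p₀‖ ≤ R := by simp [hR]
    refine (norm_add_le _ _).trans (add_le_add ?_ ((norm_add_le _ _).trans ?_))
    · refine ((B (u - D s q)).le_opNorm p₀).trans ?_
      have h1 : ‖B (u - D s q)‖ ≤ K * ‖u - D s q‖ :=
        (B.le_opNorm _).trans (by gcongr; exact hA.norm_fderiv_le _ (hp₀ s hs).1)
      calc _ ≤ (K * ‖u - D s q‖) * R := by gcongr
        _ ≤ L * ‖u - D s q‖ := by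
          rw [hL]; nlinarith [norm_nonneg (u - D s q)]
    · have h1 : ‖(A (x p s) - A (x p₀ s) - B u) p₀‖ ≤ (K * (C₁ * ‖q‖) ^ 2) * R := by
        refine ((A (x p s) - A (x p₀ s) - B u).le_opNorm p₀).trans ?_
        have := hA.norm_taylor_le _ (hp₀ s hs).1 _ (hpx s hs).1
        gcongr
        refine this.trans ?_
        gcongr
      have h2 : ‖(A (x p s) - A (x p₀ s)) q‖ ≤ (K * (C₁ * ‖q‖)) * ‖q‖ := by
        refine ((A (x p s) - A (x p₀ s)).le_opNorm q).trans ?_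
        have := hA.norm_sub_le _ (hp₀ s hs).1 _ (hpx s hs).1
        gcongr
        refine this.trans ?_
        gcongr
      rw [hC₂]
      linarith
  rw [hasFDerivAt_iff_isLittleO]
  have hlo : (fun p ↦ (‖x p 0 - x p₀ 0 - D 0 (p - p₀)‖ + C₂ * ‖p - p₀‖ ^ 2) * Real.exp (L * T))
      =o[𝓝 p₀] fun p ↦ p - p₀ := by
    simp_rw [mul_comm _ (Real.exp (L * T))]
    refine Asymptotics.IsLittleO.const_mul_left ?_ _
    refine (hasFDerivAt_iff_isLittleO.1 h0).norm_left.add ?_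
    refine Asymptotics.IsLittleO.const_mul_left ?_ _
    exact (Asymptotics.isLittleO_pow_sub_sub p₀ one_lt_two)
  refine (Asymptotics.IsBigO.of_bound 1 ?_).trans_isLittleO hlo
  filter_upwards [hw] with p hp
  rw [one_mul]
  exact hp.trans (le_abs_self _)

end ParametricODE

end

/-! ### The derivative of the exponential map. -/

noncomputable section

section ExponentialDeriv

open Set Filter Topology Metric

variable {E : Type*} [NormedAddCommGroup E] [NormedSpace ℝ E]
  {G : Type*} [TopologicalSpace G] [ChartedSpace E G] [Group G] [LieGroup 𝓘(ℝ, E) ∞ G]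
  [CompleteSpace E] [T2Space G]

/-- By uniqueness the chart solution is the translated one-parameter subgroup, so the latter stays
in the chart domain for the time `δ`. -/
theorem mul_gexp_mem_of_solution {ρ δ : ℝ} (hδ : 0 < δ)
    (hρ : closedBall (onePt E G) ρ ⊆ (oneChart E G).target) {p : E} {h : G}
    (hh : h ∈ (oneChart E G).source) {α : ℝ → E} (hα0 : α 0 = oneChart E G h)
    (hα : ∀ s ∈ Icc (-δ) δ, α s ∈ closedBall (onePt E G) ρ ∧
        HasDerivWithinAt α (leftFrame E G (α s) p) (Icc (-δ) δ) s) {s : ℝ} (hs : s ∈ Ioo (-δ) δ) :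
    h * gexp (s • p) ∈ (oneChart E G).source ∧
      oneChart E G (h * gexp (s • p)) ∈ closedBall (onePt E G) ρ := by
  have key : EqOn (fun s ↦ (oneChart E G).symm (α s)) (fun s ↦ h * gexp (s • p)) (Ioo (-δ) δ) := by
    refine eqOn_of_hasLeftFDerivAt (X := p) (by constructor <;> linarith) (fun s hs ↦ ?_)
      (fun s _ ↦ hasLeftFDerivAt_gexp_smul h p s) ?_
    · have hs' := Ioo_subset_Icc_self hs
      have hd : HasDerivAt α (leftFrame E G (α s) p) s :=
        (hα s hs').2.hasDerivAt (Icc_mem_nhds hs.1 hs.2)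
      have ht : α s ∈ (oneChart E G).target := hρ (hα s hs').1
      refine hasLeftFDerivAt_of_hasFDerivAt
        (((oneChart E G).continuousAt_symm ht).comp hd.continuousAt)
        ((oneChart E G).map_target ht) ?_
      rw [(oneChart E G).right_inv ht]
      have h1 : HasFDerivAt α ((leftFrame E G (α s)).comp ((1 : ℝ →L[ℝ] ℝ).smulRight p)) s := by
        refine hd.hasFDerivAt.congr_fderiv ?_
        ext; simp
      refine h1.congr_of_eventuallyEq ?_
      filter_upwards [isOpen_Ioo.mem_nhds hs] with u hu
      exact (oneChart E G).right_inv (hρ (hα u (Ioo_subset_Icc_self hu)).1)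
    · simp [hα0, gexp_zero, (oneChart E G).left_inv hh]
  have hm := (hα s (Ioo_subset_Icc_self hs)).1
  have hk := key hs
  simp only at hk
  rw [← hk, (oneChart E G).right_inv (hρ hm)]
  exact ⟨(oneChart E G).map_target (hρ hm), hm⟩

omit [CompleteSpace E] [T2Space G] in
theorem HasLeftFDerivAt.hasDerivAt {γ : ℝ → G} {X : E} {t : ℝ}
    (h : HasLeftFDerivAt γ ((1 : ℝ →L[ℝ] ℝ).smulRight X) t) (ht : γ t ∈ (oneChart E G).source) :
    HasDerivAt (fun t ↦ oneChart E G (γ t)) (leftFrame E G (oneChart E G (γ t)) X) t := by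
  have := (h.hasFDerivAt ht).hasDerivAt
  simpa using this

/-- If `Ψ' = 1 - ad X ∘ Ψ` and `Ψ t` is the left logarithmic derivative at `X` of
`X' ↦ exp (t X')`, then the same is true for slightly larger times. -/
theorem exists_hasLeftFDerivAt_gexp_add (X : E) {Ψ : ℝ → E →L[ℝ] E}
    (hΨ : ∀ t, HasDerivAt Ψ (1 - lieBr E G X * Ψ t) t) :
    ∃ δ > 0, ∀ t, HasLeftFDerivAt (fun X' ↦ (gexp (t • X') : G)) (Ψ t) X → ∀ s ∈ Icc 0 δ,
      HasLeftFDerivAt (fun X' ↦ (gexp ((t + s) • X') : G)) (Ψ (t + s)) X := by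
  have := topologicalGroup_of_lieGroup (G := G) 𝓘(ℝ, E) ∞
  obtain ⟨ρ, hρ, K, hK, hball, hA⟩ := exists_taylorBounds
    (contDiffAt_leftFrame E G (onePt_mem_target E G))
    ((oneChart E G).open_target.mem_nhds (onePt_mem_target E G))
  obtain ⟨δ, hδ, hsol⟩ := hA.exists_solution hρ hK (‖X‖ + 1) (by positivity)
  refine ⟨δ / 2, by positivity, fun t ht s hs ↦ ?_⟩
  have hsub : Icc 0 (δ / 2) ⊆ Ioo (-δ) δ := fun u hu ↦ ⟨by linarith [hu.1], by linarith [hu.2]⟩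
  set g : G := gexp (t • X) with hg
  have hgt := ht.const_mul g⁻¹
  -- Translation by `g⁻¹` makes the curve for `p = X` start at the identity, so the same ball and
  -- the same `δ` serve for all `t`.
  set x : E → ℝ → E := fun p s ↦ oneChart E G (g⁻¹ * gexp (t • p) * gexp (s • p)) with hx
  have hev : ∀ᶠ p in 𝓝 X, ∀ s ∈ Icc 0 (δ / 2),
      g⁻¹ * gexp (t • p) * gexp (s • p) ∈ (oneChart E G).source ∧
      x p s ∈ closedBall (onePt E G) ρ := by
    have h1 : ∀ᶠ p in 𝓝 X, ‖p‖ < ‖X‖ + 1 :=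
      continuous_norm.continuousAt.eventually_lt continuousAt_const (by simp)
    have h2 : ∀ᶠ p in 𝓝 X, g⁻¹ * gexp (t • p) ∈ (oneChart E G).source :=
      hgt.1.preimage_mem_nhds ((oneChart E G).open_source.mem_nhds (by simp [hg]))
    have h3 : ∀ᶠ p in 𝓝 X, oneChart E G (g⁻¹ * gexp (t • p)) ∈
        closedBall (onePt E G) (ρ / 2) := by
      refine ht.2.continuousAt.preimage_mem_nhds (closedBall_mem_nhds_of_mem ?_)
      simp only [inv_mul_cancel]
      exact mem_ball_self (by positivity)
    filter_upwards [h1, h2, h3] with p hp1 hp2 hp3 u hu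
    obtain ⟨α, hα0, hα⟩ := hsol p hp1.le _ hp3
    exact mul_gexp_mem_of_solution hδ hball hp2 hα0 hα (hsub hu)
  have hderiv : ∀ p, ∀ u, g⁻¹ * gexp (t • p) * gexp (u • p) ∈ (oneChart E G).source →
      HasDerivAt (x p) (leftFrame E G (x p u) p) u := fun p u hpu ↦
    (hasLeftFDerivAt_gexp_smul (g⁻¹ * gexp (t • p)) p u).hasDerivAt hpu
  have hXs := hev.self_of_nhds
  -- The candidate derivative is the frame composed with `Ψ`. The bracket relation of the frame and
  -- `Ψ' = 1 - ad X ∘ Ψ` say exactly that it solves the linearized equation.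
  have hD : ∀ u ∈ Icc 0 (δ / 2), ∀ q, HasDerivWithinAt
      (fun u ↦ (leftFrame E G (x X u)).comp (Ψ (t + u)) q)
      (fderiv ℝ (leftFrame E G) (x X u) ((leftFrame E G (x X u)).comp (Ψ (t + u)) q) X +
        leftFrame E G (x X u) q) (Icc 0 (δ / 2)) u := by
    intro u hu q
    have hxt : x X u ∈ (oneChart E G).target := hball (hXs u hu).2
    have h1 : HasDerivAt (fun u ↦ leftFrame E G (x X u))
        (fderiv ℝ (leftFrame E G) (x X u) (leftFrame E G (x X u) X)) u :=
      ((contDiffAt_leftFrame E G hxt).differentiableAt (by simp)).hasFDerivAt.comp_hasDerivAt u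
        (hderiv X u (hXs u hu).1)
    have h2 : HasDerivAt (fun u ↦ Ψ (t + u) q) ((1 - lieBr E G X * Ψ (t + u)) q) u := by
      have h3 : HasDerivAt (fun u ↦ Ψ (t + u)) (1 - lieBr E G X * Ψ (t + u)) u := by
        simpa using (hΨ (t + u)).comp_const_add t u
      have := h3.clm_apply (hasDerivAt_const u q)
      simpa using this
    have h4 := h1.clm_apply h2
    refine h4.hasDerivWithinAt.congr_deriv ?_
    have h5 := leftFrame_bracket E G hxt X (Ψ (t + u) q)
    rw [← lieBr_apply, sub_eq_iff_eq_add] at h5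
    rw [h5]
    simp only [sub_apply, one_apply_eq_self, mul_apply_eq_comp, map_sub,
      ContinuousLinearMap.comp_apply]
    abel
  have hmain := hA.hasFDerivAt_solution hK (p₀ := X) (x := x) (T := δ / 2)
    (D := fun u ↦ (leftFrame E G (x X u)).comp (Ψ (t + u))) (by positivity)
    (by filter_upwards [hev] with p hp u hu using
      ⟨(hp u hu).2, (hderiv p u (hp u hu).1).hasDerivWithinAt⟩)
    hD ?_ hs
  · have hcont : ContinuousAt (fun p ↦ g⁻¹ * gexp ((t + s) • p)) X := by
      have h1 : ContinuousAt (fun p ↦ (oneChart E G).symm (x p s)) X :=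
        ContinuousAt.comp (f := fun p ↦ x p s)
          ((oneChart E G).continuousAt_symm (hball (hXs s hs).2)) hmain.continuousAt
      refine h1.congr ?_
      filter_upwards [hev] with p hp
      rw [hx, (oneChart E G).left_inv (hp s hs).1, mul_assoc, ← gexp_add_smul]
    have hsrc : g⁻¹ * gexp ((t + s) • X) ∈ (oneChart E G).source := by
      rw [gexp_add_smul, ← mul_assoc]
      exact (hXs s hs).1
    have hfin := hasLeftFDerivAt_of_hasFDerivAt (L := Ψ (t + s)) hcont hsrc (by
      simpa only [hx, mul_assoc, ← gexp_add_smul] using hmain)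
    simpa using hfin.const_mul g
  · have h1 : x X 0 = onePt E G := by simp [hx, hg, gexp_zero]
    have h2 : (fun p ↦ x p 0) = fun p ↦ oneChart E G (g⁻¹ * gexp (t • p)) := by
      funext p; simp [hx, gexp_zero]
    simp only [h1, h2, add_zero, leftFrame_onePt]
    exact ht.2

/-- Since the step length does not depend on the time already reached, finitely many steps of length
`1 / n ≤ δ` lead from 0 to 1. -/
theorem hasLeftFDerivAt_gexp_of_ode (X : E) {Ψ : ℝ → E →L[ℝ] E} (hΨ0 : Ψ 0 = 0)
    (hΨ : ∀ t, HasDerivAt Ψ (1 - lieBr E G X * Ψ t) t) :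
    HasLeftFDerivAt (gexp : E → G) (Ψ 1) X := by
  obtain ⟨δ, hδ, hstep⟩ := exists_hasLeftFDerivAt_gexp_add (G := G) X hΨ
  obtain ⟨n, hn⟩ := exists_nat_gt (1 / δ)
  have hn0 : 0 < (n : ℝ) := lt_trans (by positivity) hn
  have key : ∀ k : ℕ, HasLeftFDerivAt (fun X' ↦ (gexp (((k : ℝ) / n) • X') : G))
      (Ψ ((k : ℝ) / n)) X := by
    intro k
    induction k with
    | zero =>
      simp only [Nat.cast_zero, zero_div, zero_smul, hΨ0, gexp_zero]
      exact ⟨continuousAt_const, by simpa using hasFDerivAt_const _ _⟩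
    | succ k ih =>
      have := hstep _ ih (1 / n) ⟨by positivity, by
        rw [div_le_iff₀ hn0]
        rw [div_lt_iff₀ hδ] at hn
        linarith⟩
      convert this using 3 <;> push_cast <;> ring_nf
  simpa [hn0.ne'] using key n

theorem IsNilpotentBracket.hasLeftFDerivAt_gexp {C : ℕ → Submodule ℝ E} {N : ℕ}
    (h : IsNilpotentBracket (lieBr E G) C N) (X : E) :
    HasLeftFDerivAt (gexp : E → G) (expJacobian N 1 (lieBr E G X)) X :=
  hasLeftFDerivAt_gexp_of_ode X (Ψ := fun t ↦ expJacobian N t (lieBr E G X))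
    (expJacobian_zero _ _) fun t ↦ hasDerivAt_expJacobian (h.pow_eq_zero X) t

end ExponentialDeriv

end

/-! ### The exponential map is a covering map and a homeomorphism. -/

noncomputable section

section ExponentialHomeo

open Set Filter Topology Metric

variable {E : Type*} [NormedAddCommGroup E] [NormedSpace ℝ E]
  {G : Type*} [TopologicalSpace G] [ChartedSpace E G] [Group G] [LieGroup 𝓘(ℝ, E) ∞ G]
  [CompleteSpace E] [T2Space G] {C : ℕ → Submodule ℝ E} {N : ℕ}

namespace IsNilpotentBracket

/-- The operator `(1 - e^{-ad X}) / ad X` as an equivalence. -/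
def jacobianEquiv {ad : E →L[ℝ] E →L[ℝ] E} (h : IsNilpotentBracket ad C N) (X : E) : E ≃L[ℝ] E :=
  ContinuousLinearEquiv.equivOfInverse (expJacobian N 1 (ad X)) (expJacobianInv N (ad X))
    (fun x ↦ congrArg (fun T : E →L[ℝ] E ↦ T x) (h.expJacobianInv_mul X))
    (fun x ↦ congrArg (fun T : E →L[ℝ] E ↦ T x) (h.expJacobian_mul_inv X))

theorem continuous_gexp (h : IsNilpotentBracket (lieBr E G) C N) : Continuous (gexp : E → G) :=
  continuous_iff_continuousAt.2 fun X ↦ (h.hasLeftFDerivAt_gexp X).1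

/-- The exponential map in the chart obtained from the one at the identity by a translation. -/
theorem hasStrictFDerivAt_oneChart_gexp (h : IsNilpotentBracket (lieBr E G) C N) (X : E) :
    HasStrictFDerivAt (fun Z ↦ oneChart E G ((gexp X)⁻¹ * gexp Z))
      (h.jacobianEquiv X : E →L[ℝ] E) X := by
  have := topologicalGroup_of_lieGroup (G := G) 𝓘(ℝ, E) ∞
  have hc : Continuous fun Z ↦ ((gexp X)⁻¹ * gexp Z : G) := continuous_const.mul h.continuous_gexp
  have hX : (gexp X)⁻¹ * gexp X ∈ (oneChart E G).source := by simp
  have h1 : ∀ᶠ Z in 𝓝 X, HasFDerivAt (fun Z ↦ oneChart E G ((gexp X)⁻¹ * gexp Z))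
      ((leftFrame E G (oneChart E G ((gexp X)⁻¹ * gexp Z))).comp
        (expJacobian N 1 (lieBr E G Z))) Z := by
    filter_upwards [hc.continuousAt.preimage_mem_nhds ((oneChart E G).open_source.mem_nhds hX)]
      with Z hZ
    exact ((h.hasLeftFDerivAt_gexp Z).const_mul _).hasFDerivAt hZ
  -- Strict differentiability, needed for the inverse function theorem, follows from continuity of
  -- the derivative.
  have h2 := hasStrictFDerivAt_of_hasFDerivAt_of_continuousAt h1 ?_
  · simp only [inv_mul_cancel, leftFrame_onePt] at h2
    exact h2
  · have h3 : ContinuousAt (fun Z ↦ leftFrame E G (oneChart E G ((gexp X)⁻¹ * gexp Z))) X := by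
      have h4 : ContinuousAt (leftFrame E G) (oneChart E G ((gexp X)⁻¹ * gexp X)) :=
        (contDiffAt_leftFrame E G ((oneChart E G).map_source hX)).continuousAt
      have h5 : ContinuousAt (fun Z ↦ oneChart E G ((gexp X)⁻¹ * gexp Z)) X :=
        ContinuousAt.comp (f := fun Z ↦ ((gexp X)⁻¹ * gexp Z : G))
          ((oneChart E G).continuousAt hX) hc.continuousAt
      exact ContinuousAt.comp (f := fun Z ↦ oneChart E G ((gexp X)⁻¹ * gexp Z)) h4 h5
    have h6 : Continuous fun Z ↦ expJacobian N 1 (lieBr E G Z) :=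
      (continuous_expJacobian N 1).comp (lieBr E G).continuous
    exact h3.clm_comp h6.continuousAt

theorem isLocalHomeomorph_gexp (h : IsNilpotentBracket (lieBr E G) C N) :
    IsLocalHomeomorph (gexp : E → G) := by
  have := topologicalGroup_of_lieGroup (G := G) 𝓘(ℝ, E) ∞
  refine IsLocalHomeomorph.mk _ fun X ↦ ?_
  have hs := h.hasStrictFDerivAt_oneChart_gexp X
  have hc : Continuous fun Z ↦ ((gexp X)⁻¹ * gexp Z : G) := continuous_const.mul h.continuous_gexp
  have hX : (gexp X)⁻¹ * gexp X ∈ (oneChart E G).source := by simp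
  let e := (((hs.toOpenPartialHomeomorph _).restrOpen
    ((fun Z ↦ ((gexp X)⁻¹ * gexp Z : G)) ⁻¹' (oneChart E G).source)
    ((oneChart E G).open_source.preimage hc)).trans (oneChart E G).symm).trans
    (Homeomorph.mulLeft (gexp X : G)).toOpenPartialHomeomorph
  have hsrc : ∀ Z, Z ∈ e.source ↔ (Z ∈ (hs.toOpenPartialHomeomorph _).source ∧
      (gexp X)⁻¹ * gexp Z ∈ (oneChart E G).source) ∧
      oneChart E G ((gexp X)⁻¹ * gexp Z) ∈ (oneChart E G).target := by
    intro Z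
    simp [e]
  refine ⟨e, (hsrc X).2 ⟨⟨hs.mem_toOpenPartialHomeomorph_source, hX⟩,
    (oneChart E G).map_source hX⟩, fun Z hZ ↦ ?_⟩
  have h1 := (oneChart E G).left_inv ((hsrc Z).1 hZ).1.2
  change gexp Z = gexp X * (oneChart E G).symm (oneChart E G ((gexp X)⁻¹ * gexp Z))
  rw [h1]
  simp

/-- A substitute for injectivity of `exp` as long as that is unknown: a local homeomorphism cannot
collapse a nonconstant curve. -/
theorem eq_of_gexp_const (h : IsNilpotentBracket (lieBr E G) C N) {γ : ℝ → E} (hγ : Continuous γ)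
    (hc : ∀ s t, (gexp (γ s) : G) = gexp (γ t)) (s t : ℝ) : γ s = γ t :=
  (T2Space.isSeparatedMap (gexp : E → G)).const_of_comp h.isLocalHomeomorph_gexp.isLocallyInjective
    hγ hc s t

variable [FiniteDimensional ℝ E]

/-- With `u' = J(u)⁻¹ Y`, the left logarithmic derivative of `exp u` is `J(u) J(u)⁻¹ Y = Y`, a
constant. -/
theorem gexp_bchFlow (h : IsNilpotentBracket (lieBr E G) C N) (X Y : E) (t : ℝ) :
    (gexp (bchFlow (lieBr E G) N X Y t) : G) = gexp X * gexp (t • Y) := by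
  have h1 := eq_mul_gexp_smul (γ := fun t ↦ (gexp (bchFlow (lieBr E G) N X Y t) : G)) (X := Y)
    (fun t ↦ ?_) t
  · simpa [h.bchFlow_zero] using h1
  · have h2 := HasLeftFDerivAt.comp t (h.hasLeftFDerivAt_gexp (bchFlow (lieBr E G) N X Y t))
      (h.hasDerivAt_bchFlow X Y t).hasFDerivAt
    convert h2 using 1
    ext
    simp only [ContinuousLinearMap.comp_apply, ContinuousLinearMap.smulRight_apply, one_smul,
      ContinuousLinearMap.toSpanSingleton_apply, one_apply_eq_self]
    exact (congrArg (fun T : E →L[ℝ] E ↦ T Y) (h.expJacobian_mul_inv _)).symm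

/-- The Baker-Campbell-Hausdorff multiplication on the Lie algebra. -/
def _root_.bchMul (ad : E →L[ℝ] E →L[ℝ] E) (N : ℕ) (X Y : E) : E := bchFlow ad N X Y 1

omit [CompleteSpace E] [FiniteDimensional ℝ E] in
theorem _root_.continuous_bchMul (ad : E →L[ℝ] E →L[ℝ] E) (N : ℕ) :
    Continuous fun p : E × E ↦ bchMul ad N p.1 p.2 :=
  (continuous_bchFlow ad N).comp (by fun_prop : Continuous fun p : E × E ↦ (p.1, p.2, (1 : ℝ)))

theorem gexp_bchMul (h : IsNilpotentBracket (lieBr E G) C N) (X Y : E) :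
    (gexp (bchMul (lieBr E G) N X Y) : G) = gexp X * gexp Y := by
  rw [bchMul, h.gexp_bchFlow, one_smul]

omit [CompleteSpace E] in
theorem bchMul_zero {ad : E →L[ℝ] E →L[ℝ] E} (h : IsNilpotentBracket ad C N) (X : E) :
    bchMul ad N X 0 = X := by
  rw [bchMul, h.bchFlow_eq]
  simp

/-- Both sides have the same exponential. To conclude without injectivity, replace `Y` by `t • Y`:
the left side is then a continuous curve with constant exponential, equal to `X` at `t = 0`. -/
theorem bchMul_neg_cancel (h : IsNilpotentBracket (lieBr E G) C N) (X Y : E) :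
    bchMul (lieBr E G) N (bchMul (lieBr E G) N X Y) (-Y) = X := by
  have hc : Continuous fun t : ℝ ↦
      bchMul (lieBr E G) N (bchMul (lieBr E G) N X (t • Y)) (-(t • Y)) := by
    have := continuous_bchMul (lieBr E G) N
    exact this.comp (((this.comp (by fun_prop : Continuous fun t : ℝ ↦ (X, t • Y)))).prodMk
      (by fun_prop))
  have := h.eq_of_gexp_const (G := G) hc (fun s t ↦ by simp [h.gexp_bchMul, gexp_neg]) 1 0
  simpa [h.bchMul_zero] using this

/-- Let `e` be a local inverse chart of `exp` at 0. Over the translate of `e.target` by `g`, the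
product on the Lie algebra trivializes `exp`: the fibre coordinate of `Z` is `Z` times the inverse
of `e.symm (g⁻¹ * exp Z)`, which lies over `g`. The cancellation rule makes this bijective. -/
theorem isCoveringMap_gexp (h : IsNilpotentBracket (lieBr E G) C N) :
    IsCoveringMap (gexp : E → G) := by
  have := topologicalGroup_of_lieGroup (G := G) 𝓘(ℝ, E) ∞
  intro g
  have hloc := h.isLocalHomeomorph_gexp
  have hdisc : DiscreteTopology ((gexp : E → G) ⁻¹' {g}) := by
    have : Subsingleton ((gexp : E → G) '' ((gexp : E → G) ⁻¹' {g})) :=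
      (subsingleton_singleton.anti (image_preimage_subset _ _)).coe_sort
    exact (hloc.isLocalHomeomorphOn.mono (subset_univ _)).discreteTopology_of_image
  obtain ⟨e, he0, he⟩ := hloc 0
  have heg : ∀ X, e X = gexp X := fun X ↦ (congrFun he X).symm
  have hopen : IsOpen ((fun y ↦ g⁻¹ * y) ⁻¹' e.target) :=
    e.open_target.preimage (continuous_const.mul continuous_id)
  have hcm := continuous_bchMul (lieBr E G) N
  have hec : Continuous fun y : ((fun y ↦ g⁻¹ * y) ⁻¹' e.target) ↦ e.symm (g⁻¹ * y) := by
    rw [continuous_iff_continuousAt]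
    intro y
    exact ContinuousAt.comp (f := fun y : ((fun y ↦ g⁻¹ * y) ⁻¹' e.target) ↦ g⁻¹ * y.1)
      (e.continuousAt_symm y.2) (by fun_prop)
  have hexp : ∀ y ∈ ((fun y ↦ g⁻¹ * y) ⁻¹' e.target), (gexp (e.symm (g⁻¹ * y)) : G) = g⁻¹ * y :=
    fun y hy ↦ by rw [← heg, e.right_inv hy]
  have hrev : ∀ X Y, bchMul (lieBr E G) N (bchMul (lieBr E G) N X (-Y)) Y = X := fun X Y ↦ by
    simpa using h.bchMul_neg_cancel X (-Y)
  refine ⟨hdisc, (fun y ↦ g⁻¹ * y) ⁻¹' e.target, ?_, hopen, hopen.preimage h.continuous_gexp, ?_⟩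
  · have := e.map_source he0
    rw [heg, gexp_zero] at this
    simpa using this
  · refine ⟨⟨⟨fun Z ↦ (⟨gexp Z.1, Z.2⟩, ⟨bchMul (lieBr E G) N Z.1
      (-(e.symm (g⁻¹ * gexp Z.1))), ?_⟩), fun p ↦ ⟨bchMul (lieBr E G) N p.2.1
        (e.symm (g⁻¹ * p.1.1)), ?_⟩, ?_, ?_⟩, ?_, ?_⟩, fun Z ↦ rfl⟩
    · simp only [mem_preimage, mem_singleton_iff]
      rw [h.gexp_bchMul, gexp_neg, hexp _ Z.2]
      simp
    · have h1 : gexp p.2.1 = g := p.2.2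
      have h2 := p.1.2
      simp only [mem_preimage] at h2 ⊢
      rw [h.gexp_bchMul, hexp _ p.1.2, h1]
      simpa using h2
    · intro Z
      apply Subtype.ext
      simp only
      rw [hrev]
    · intro p
      have h1 : gexp p.2.1 = g := p.2.2
      have h2 : gexp (bchMul (lieBr E G) N p.2.1 (e.symm (g⁻¹ * p.1.1))) = p.1.1 := by
        rw [h.gexp_bchMul, hexp _ p.1.2, h1]
        simp
      refine Prod.ext (Subtype.ext h2) (Subtype.ext ?_)
      simp only [h2]
      exact h.bchMul_neg_cancel _ _
    · refine Continuous.prodMk (Continuous.subtype_mk (h.continuous_gexp.comp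
        continuous_subtype_val) _) (Continuous.subtype_mk ?_ _)
      have h3 := hec.comp (Continuous.subtype_mk (h.continuous_gexp.comp
        continuous_subtype_val) (fun Z : (gexp : E → G) ⁻¹' ((fun y ↦ g⁻¹ * y) ⁻¹' e.target) ↦ Z.2))
      exact hcm.comp (continuous_subtype_val.prodMk h3.neg)
    · refine Continuous.subtype_mk ?_ _
      exact hcm.comp ((continuous_subtype_val.comp continuous_snd).prodMk (hec.comp continuous_fst))

theorem exists_homeomorph_gexp [SimplyConnectedSpace G]
    (h : IsNilpotentBracket (lieBr E G) C N) :
    ∃ Φ : E ≃ₜ G, (∀ X, Φ X = gexp X) ∧ ∀ g, Φ.symm g = lieLog (E := E) g := by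
  have hcov := h.isCoveringMap_gexp
  have : LocallyPathConnectedSpace G := ChartedSpace.locallyPathConnectedSpace E G
  -- Simple connectedness lifts the identity of `G` to a section `s` of `exp` with `s 1 = 0`;
  -- uniqueness of lifts then gives `s ∘ exp = id`.
  obtain ⟨s, ⟨hs1, hs⟩, -⟩ := hcov.existsUnique_continuousMap_lifts (ContinuousMap.id G) 1 0
    (by simpa using gexp_zero)
  have hr : ∀ g, gexp (s g) = g := fun g ↦ congrFun hs g
  have hl : (s : G → E) ∘ (gexp : E → G) = id := by
    refine hcov.eq_of_comp_eq (s.continuous.comp h.continuous_gexp) continuous_id ?_ 0 ?_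
    · funext X
      simp [hr]
    · simp [gexp_zero, hs1]
  refine ⟨⟨⟨gexp, s, fun X ↦ congrFun hl X, hr⟩, h.continuous_gexp, s.continuous⟩, fun X ↦ rfl,
    fun g ↦ ?_⟩
  have hinj : Function.Injective (gexp : E → G) :=
    Function.LeftInverse.injective (g := s) fun X ↦ congrFun hl X
  have h1 : lieLog (E := E) (gexp (s g)) = s g := Function.leftInverse_invFun hinj (s g)
  rw [hr] at h1
  exact h1.symm

end IsNilpotentBracket

end ExponentialHomeo

end

/-! ### Haar measure in exponential coordinates. -/

noncomputable section

section HaarMeasure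

open Set Filter Topology Metric

variable {E : Type*} [NormedAddCommGroup E] [NormedSpace ℝ E]
  {G : Type*} [TopologicalSpace G] [ChartedSpace E G] [Group G] [LieGroup 𝓘(ℝ, E) ∞ G]
  [T2Space G] {C : ℕ → Submodule ℝ E} {N : ℕ} [FiniteDimensional ℝ E]
  [MeasurableSpace E] [BorelSpace E]

/-- The left translation by `g` in exponential coordinates. -/
def expTranslation (Φ : E ≃ₜ G) (g : G) [IsTopologicalGroup G] : E ≃ₜ E :=
  (Φ.trans (Homeomorph.mulLeft g)).trans Φ.symm

namespace IsNilpotentBracket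

omit [MeasurableSpace E] [BorelSpace E] in
-- Left logarithmic derivatives ignore left translations, so `J(T Y) ∘ T' = J(Y)`; the local inverse
-- at `T Y` isolates `T'`.
theorem hasFDerivAt_expTranslation [IsTopologicalGroup G] (h : IsNilpotentBracket (lieBr E G) C N)
    (Φ : E ≃ₜ G) (hΦ : ∀ X, Φ X = gexp X) (g : G) (Y : E) :
    HasFDerivAt (expTranslation Φ g)
      (((h.jacobianEquiv (expTranslation Φ g Y)).symm : E →L[ℝ] E).comp
        (h.jacobianEquiv Y : E →L[ℝ] E)) Y := by
  have := FiniteDimensional.complete ℝ E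
  set T := expTranslation Φ g with hT
  have hTg : ∀ W, (gexp (T W) : G) = g * gexp W := fun W ↦ by
    rw [← hΦ, ← hΦ]
    simp [hT, expTranslation]
  have h1 := h.hasStrictFDerivAt_oneChart_gexp (G := G) (T Y)
  have h2 := (h.hasStrictFDerivAt_oneChart_gexp (G := G) Y).hasFDerivAt
  have h3 : (fun W ↦ oneChart E G ((gexp (T Y))⁻¹ * gexp (T W))) =
      fun W ↦ oneChart E G ((gexp Y)⁻¹ * gexp W) := by
    funext W
    rw [hTg, hTg]
    group
  have h4 := h1.to_localInverse.hasFDerivAt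
  have h5 : oneChart E G ((gexp (T Y))⁻¹ * gexp (T Y)) = oneChart E G ((gexp Y)⁻¹ * gexp Y) := by
    simp
  rw [h5] at h4
  refine (HasFDerivAt.comp Y (f := fun W ↦ oneChart E G ((gexp Y)⁻¹ * gexp W)) h4 h2
    ).congr_of_eventuallyEq ?_
  filter_upwards [T.continuous.continuousAt.eventually h1.eventually_left_inverse] with W hW
  rw [← hW, ← h3]
  rfl

omit [MeasurableSpace E] [BorelSpace E] in
theorem det_expTranslation {ad : E →L[ℝ] E →L[ℝ] E} (h : IsNilpotentBracket ad C N) (X Y : E) :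
    (((h.jacobianEquiv X).symm : E →L[ℝ] E).comp (h.jacobianEquiv Y : E →L[ℝ] E)).det = 1 := by
  have h1 : ∀ X, LinearMap.det ((h.jacobianEquiv X : E →L[ℝ] E) : E →ₗ[ℝ] E) = 1 := fun X ↦
    h.det_expJacobian X
  have h2 : LinearMap.det ((((h.jacobianEquiv X).symm : E →L[ℝ] E) : E →ₗ[ℝ] E) ∘ₗ
      ((h.jacobianEquiv X : E →L[ℝ] E) : E →ₗ[ℝ] E)) = 1 := by
    convert LinearMap.det_id (A := ℝ) (M := E)
    ext; simp
  rw [LinearMap.det_comp, h1, mul_one] at h2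
  rw [ContinuousLinearMap.det, ContinuousLinearMap.toLinearMap_comp, LinearMap.det_comp, h1, h2,
    mul_one]

theorem map_expTranslation [IsTopologicalGroup G] (h : IsNilpotentBracket (lieBr E G) C N)
    (Φ : E ≃ₜ G) (hΦ : ∀ X, Φ X = gexp X) (g : G) (ν : Measure E) [ν.IsAddHaarMeasure] :
    ν.map (expTranslation Φ g) = ν := by
  have := map_withDensity_abs_det_fderiv_eq_addHaar ν MeasurableSet.univ.nullMeasurableSet
    (fun Y _ ↦ (h.hasFDerivAt_expTranslation Φ hΦ g Y).hasFDerivWithinAt)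
    (expTranslation Φ g).injective.injOn
  simp only [h.det_expTranslation, abs_one, ENNReal.ofReal_one, Measure.restrict_univ, image_univ,
    (expTranslation Φ g).surjective.range_eq] at this
  rwa [show (fun _ : E ↦ (1 : ℝ≥0∞)) = 1 from rfl, withDensity_one] at this

variable [MeasurableSpace G] [BorelSpace G]

theorem isMulLeftInvariant_map [IsTopologicalGroup G] (h : IsNilpotentBracket (lieBr E G) C N)
    (Φ : E ≃ₜ G) (hΦ : ∀ X, Φ X = gexp X) (ν : Measure E) [ν.IsAddHaarMeasure] :
    (ν.map Φ).IsMulLeftInvariant := by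
  refine ⟨fun g ↦ ?_⟩
  have h1 : (fun y ↦ g * y) ∘ Φ = Φ ∘ expTranslation Φ g := by
    funext X; simp [expTranslation]
  rw [Measure.map_map (measurable_const_mul g) Φ.continuous.measurable, h1,
    ← Measure.map_map Φ.continuous.measurable (expTranslation Φ g).continuous.measurable,
    h.map_expTranslation Φ hΦ]

/-- Uniqueness of Haar measure, applied to the left-invariant image of Lebesgue measure. The factor
is nonzero because that image is nonzero. -/
theorem exists_map_eq_smul [IsTopologicalGroup G] (h : IsNilpotentBracket (lieBr E G) C N)
    (Φ : E ≃ₜ G) (hΦ : ∀ X, Φ X = gexp X) (ν : Measure E) [ν.IsAddHaarMeasure]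
    (μ : Measure G) [μ.IsHaarMeasure] :
    ∃ c : ℝ≥0∞, c ≠ 0 ∧ c ≠ ⊤ ∧ μ = c • ν.map Φ := by
  have := h.isMulLeftInvariant_map Φ hΦ ν
  have : SecondCountableTopology G := Φ.symm.isEmbedding.secondCountableTopology
  have : LocallyCompactSpace G := Φ.symm.isClosedEmbedding.locallyCompactSpace
  have : IsFiniteMeasureOnCompacts (ν.map Φ) := ⟨fun K hK ↦ by
    rw [Measure.map_apply Φ.continuous.measurable hK.measurableSet]
    exact (Φ.isCompact_preimage.2 hK).measure_lt_top⟩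
  have h1 := Measure.isMulLeftInvariant_eq_smul (ν.map Φ) μ
  set r := Measure.haarScalarFactor (ν.map Φ) μ with hr
  have hr0 : r ≠ 0 := by
    intro h0
    rw [h0, zero_smul] at h1
    have h2 : ν.map Φ univ = ν univ := by
      rw [Measure.map_apply Φ.continuous.measurable MeasurableSet.univ, preimage_univ]
    rw [h1] at h2
    have h3 : ν = 0 := Measure.measure_univ_eq_zero.1 h2.symm
    exact NeZero.ne ν h3
  refine ⟨((r⁻¹ : NNReal) : ℝ≥0∞), by simpa using hr0, ENNReal.coe_ne_top, ?_⟩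
  rw [h1]
  change μ = (r⁻¹ : NNReal) • (r • μ)
  rw [smul_smul, inv_mul_cancel₀ hr0, one_smul]

/-- Inversion is `X ↦ -X` in exponential coordinates, which preserves Lebesgue measure;
unimodularity follows. -/
theorem isInvInvariant_of_homeomorph [IsTopologicalGroup G]
    (h : IsNilpotentBracket (lieBr E G) C N)
    (Φ : E ≃ₜ G) (hΦ : ∀ X, Φ X = gexp X) (μ : Measure G) [μ.IsHaarMeasure] :
    μ.IsInvInvariant := by
  have := FiniteDimensional.complete ℝ E
  obtain ⟨c, -, -, hc⟩ := h.exists_map_eq_smul Φ hΦ (finBasis ℝ E).addHaar μ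
  refine ⟨?_⟩
  have h1 : (Inv.inv : G → G) ∘ Φ = Φ ∘ Neg.neg := by
    funext X
    simp [hΦ, gexp_neg]
  rw [Measure.inv, hc, Measure.map_smul, Measure.map_map measurable_inv Φ.continuous.measurable,
    h1, ← Measure.map_map Φ.continuous.measurable measurable_neg, Measure.map_neg_eq_self]

theorem isMulRightInvariant_of_homeomorph [IsTopologicalGroup G]
    (h : IsNilpotentBracket (lieBr E G) C N)
    (Φ : E ≃ₜ G) (hΦ : ∀ X, Φ X = gexp X) (μ : Measure G) [μ.IsHaarMeasure] :
    μ.IsMulRightInvariant := by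
  have := h.isInvInvariant_of_homeomorph Φ hΦ μ
  rw [← μ.inv_eq_self]
  infer_instance

end IsNilpotentBracket

omit [LieGroup 𝓘(ℝ, E) ∞ G] [T2Space G] [FiniteDimensional ℝ E] in
theorem lieAlgebraHaar_eq_smul [MeasurableSpace G] [BorelSpace G] (Φ : E ≃ₜ G)
    (hΦ : ∀ g, Φ.symm g = lieLog (E := E) g) {ν : Measure E} {c : ℝ≥0∞} {μ : Measure G}
    (hc : μ = c • ν.map Φ) : lieAlgebraHaar (E := E) μ = c • ν := by
  have h1 : (lieLog : G → E) = Φ.symm := (funext hΦ).symm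
  rw [lieAlgebraHaar, h1, hc, Measure.map_smul,
    Measure.map_map Φ.symm.continuous.measurable Φ.continuous.measurable]
  simp

theorem dualHaar_smul_addHaar (c : ℝ≥0∞) :
    dualHaar (c • (finBasis ℝ E).addHaar) =
      (ENNReal.ofReal ((2 * Real.pi) ^ finrank ℝ E) * c)⁻¹ •
        (strongDualBasis (finBasis ℝ E)).addHaar := by
  rw [dualHaar, Measure.smul_apply, Basis.addHaar_self, smul_eq_mul, mul_one]

variable (E G) in
omit [T2Space G] [MeasurableSpace E] [BorelSpace E] in
theorem exists_isNilpotentBracket_lieBr [LieRing.IsNilpotent (GroupLieAlgebra 𝓘(ℝ, E) G)] :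
    ∃ (C : ℕ → Submodule ℝ E) (N : ℕ), IsNilpotentBracket (lieBr E G) C N := by
  have := FiniteDimensional.complete ℝ E
  obtain ⟨N, hN⟩ := LieModule.IsNilpotent.nilpotent ℝ (GroupLieAlgebra 𝓘(ℝ, E) G)
    (GroupLieAlgebra 𝓘(ℝ, E) G)
  -- The filtration is the lower central series.
  let D : ℕ → Submodule ℝ E := fun k ↦
    (LieModule.lowerCentralSeries ℝ (GroupLieAlgebra 𝓘(ℝ, E) G)
      (GroupLieAlgebra 𝓘(ℝ, E) G) k).toSubmodule
  refine ⟨D, N, ?_, ?_, ?_, ?_, ?_⟩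
  · change (LieModule.lowerCentralSeries ℝ (GroupLieAlgebra 𝓘(ℝ, E) G)
      (GroupLieAlgebra 𝓘(ℝ, E) G) 0).toSubmodule = ⊤
    rw [LieModule.lowerCentralSeries_zero]
    rfl
  · change (LieModule.lowerCentralSeries ℝ (GroupLieAlgebra 𝓘(ℝ, E) G)
      (GroupLieAlgebra 𝓘(ℝ, E) G) N).toSubmodule = ⊥
    rw [hN]
    rfl
  · intro i j hij
    exact LieModule.antitone_lowerCentralSeries ℝ (GroupLieAlgebra 𝓘(ℝ, E) G)
      (GroupLieAlgebra 𝓘(ℝ, E) G) hij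
  · intro k x y hy
    have key : ∀ x' y' : GroupLieAlgebra 𝓘(ℝ, E) G,
        y' ∈ LieModule.lowerCentralSeries ℝ (GroupLieAlgebra 𝓘(ℝ, E) G)
          (GroupLieAlgebra 𝓘(ℝ, E) G) k → ⁅x', y'⁆ ∈ LieModule.lowerCentralSeries ℝ
          (GroupLieAlgebra 𝓘(ℝ, E) G) (GroupLieAlgebra 𝓘(ℝ, E) G) (k + 1) := by
      intro x' y' hy'
      rw [LieModule.lowerCentralSeries_succ]
      exact LieSubmodule.lie_mem_lie (LieSubmodule.mem_top _) hy'
    exact (congrArg (fun z : E ↦ z ∈ D (k + 1)) (bracket_eq_lieBr (E := E) (G := G) x y)).mp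
      (key x y hy)
  · intro x y
    rw [lieBr_apply, lieBr_apply]
    abel

end HaarMeasure

end

/-! ### Plancherel's formula on a vector space and its dual. -/

noncomputable section

section Plancherel

open Set Filter Topology FourierTransform

section InnerProduct

variable {V : Type*} [NormedAddCommGroup V] [InnerProductSpace ℝ V] [FiniteDimensional ℝ V]
  [MeasurableSpace V] [BorelSpace V]

theorem MeasureTheory.Integrable.continuous_fourier {f : V → ℂ} (hf : Integrable f) :
    Continuous (𝓕 f) :=
  VectorFourier.fourierIntegral_continuous Real.continuous_fourierChar
    (by exact continuous_inner (𝕜 := ℝ) (E := V)) hf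

/-- On `L¹ ∩ L²`, the Fourier transform of `L²` is given by the Fourier integral. -/
theorem MeasureTheory.MemLp.fourier_toLp_ae_eq {f : V → ℂ} (h1 : Integrable f)
    (h2 : MemLp f 2) : (𝓕 (h2.toLp f) : Lp ℂ 2 (volume : Measure V)) =ᵐ[volume] 𝓕 f := by
  set F : Lp ℂ 2 (volume : Measure V) := 𝓕 (h2.toLp f) with hF
  have hloc : LocallyIntegrable (F : V → ℂ) := (Lp.memLp F).locallyIntegrable (by norm_num)
  -- Both transforms are tested against smooth compactly supported functions: one moves to the test
  -- function by the definition for distributions, the other by Fubini.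
  refine ae_eq_of_integral_contDiff_smul_eq hloc h1.continuous_fourier.locallyIntegrable
    fun g hg hgc ↦ ?_
  have hg₁ : HasCompactSupport (Complex.ofRealCLM ∘ g) := hgc.comp_left rfl
  have hg₂ : ContDiff ℝ ∞ (Complex.ofRealCLM ∘ g) := by fun_prop
  set φ := hg₁.toSchwartzMap hg₂
  have e1 : Lp.toTemperedDistribution F φ = ∫ x, g x • F x := by
    rw [Lp.toTemperedDistribution_apply]
    simp [φ]
  have e2 : Lp.toTemperedDistribution F φ = Lp.toTemperedDistribution (h2.toLp f) (𝓕 φ) := by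
    rw [hF, ← Lp.fourier_toTemperedDistribution_eq]
    rfl
  have e3 : Lp.toTemperedDistribution (h2.toLp f) (𝓕 φ) = ∫ x, (𝓕 φ) x • f x := by
    rw [Lp.toTemperedDistribution_apply]
    refine integral_congr_ae ?_
    filter_upwards [h2.coeFn_toLp] with x hx
    rw [hx]
  have e4 : ∫ x, (𝓕 φ) x • f x = ∫ x, φ x • 𝓕 f x := by
    simpa using! VectorFourier.integral_bilin_fourierIntegral_eq_flip
      (ContinuousLinearMap.lsmul ℂ ℂ) (L := innerₗ V)
      Real.continuous_fourierChar continuous_inner φ.integrable h1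
  rw [← e1, e2, e3, e4]
  simp [φ]

theorem lintegral_fourier_sq {f : V → ℂ} (h1 : Integrable f) (h2 : MemLp f 2) :
    ∫⁻ v, ‖𝓕 f v‖ₑ ^ 2 = ∫⁻ v, ‖f v‖ₑ ^ 2 := by
  have e : ∀ g : V → ℂ, ∫⁻ v, ‖g v‖ₑ ^ 2 = eLpNorm g 2 volume ^ 2 := fun g ↦ by
    have := eLpNorm_nnreal_pow_eq_lintegral (f := g) (μ := volume) (p := 2) (by norm_num)
    simp only [NNReal.coe_ofNat, ENNReal.rpow_ofNat, ENNReal.coe_ofNat] at this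
    exact this.symm
  rw [e, e, ← eLpNorm_congr_ae (h2.fourier_toLp_ae_eq h1), ← eLpNorm_congr_ae h2.coeFn_toLp]
  have := Lp.norm_fourier_eq (h2.toLp f)
  rw [Lp.norm_def, Lp.norm_def, ENNReal.toReal_eq_toReal_iff' (Lp.eLpNorm_ne_top _)
    (Lp.eLpNorm_ne_top _)] at this
  rw [this]

end InnerProduct

variable {E : Type*} [NormedAddCommGroup E] [NormedSpace ℝ E] [FiniteDimensional ℝ E]
  [MeasurableSpace E] [BorelSpace E]

omit [MeasurableSpace E] [BorelSpace E] in
theorem strongDualBasis_repr_apply {ι : Type*} [Fintype ι] (b : Basis ι ℝ E) (v : ι → ℝ)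
    (X : E) : (strongDualBasis b).equivFun.symm v X = ∑ i, v i * b.repr X i := by
  classical
  simp [strongDualBasis, Basis.equivFun_symm_apply, sum_apply]

theorem exists_equiv_map_volume_addHaar {ι : Type*} [Fintype ι] (b : Basis ι ℝ E) :
    ∃ L : EuclideanSpace ℝ ι ≃L[ℝ] E, (∀ v i, b.repr (L v) i = v i) ∧
      (∀ v, L v = b.equivFun.symm (fun i ↦ v i)) ∧
      (volume : Measure (EuclideanSpace ℝ ι)).map L = b.addHaar := by
  classical
  let B := (EuclideanSpace.basisFun ι ℝ).toBasis
  let L : EuclideanSpace ℝ ι ≃L[ℝ] E := (B.equiv b (Equiv.refl ι)).toContinuousLinearEquiv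
  have hL : ∀ v, L v = b.equivFun.symm (fun i ↦ v i) := by
    intro v
    change B.equiv b (Equiv.refl ι) v = _
    conv_lhs => rw [← B.sum_repr v]
    simp only [map_sum, map_smul, Basis.equiv_apply, Basis.equivFun_symm_apply]
    simp [B]
  refine ⟨L, fun v i ↦ ?_, hL, ?_⟩
  · rw [hL, ← Basis.equivFun_apply, LinearEquiv.apply_symm_apply]
  · rw [← (EuclideanSpace.basisFun ι ℝ).addHaar_eq_volume, Basis.map_addHaar]
    congr 1
    simp [L, B]

/-- Plancherel's formula, for the Haar measures on a vector space and on its dual. -/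
theorem lintegral_dualHaar_sq {c : ℝ≥0∞} (hc : c ≠ 0) (hc' : c ≠ ⊤) {h : E → ℂ}
    (h1 : Integrable h (finBasis ℝ E).addHaar) (h2 : MemLp h 2 (finBasis ℝ E).addHaar) :
    ∫⁻ ζ, ‖∫ X, Complex.exp (Complex.I * (ζ X : ℂ)) * h X ∂(c • (finBasis ℝ E).addHaar)‖ₑ ^ 2
      ∂dualHaar (c • (finBasis ℝ E).addHaar) = ∫⁻ X, ‖h X‖ₑ ^ 2 ∂(c • (finBasis ℝ E).addHaar) := by
  set b := finBasis ℝ E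
  obtain ⟨L, hL1, hL2, hL3⟩ := exists_equiv_map_volume_addHaar b
  obtain ⟨M, hM1, hM2, hM3⟩ := exists_equiv_map_volume_addHaar (strongDualBasis b)
  have hLM : ∀ v u, M v (L u) = ⟪u, v⟫_ℝ := by
    intro v u
    rw [hM2, strongDualBasis_repr_apply]
    simp [hL1, PiLp.inner_apply]
  have mpL : MeasurePreserving L volume b.addHaar := ⟨L.continuous.measurable, hL3⟩
  have mpM : MeasurePreserving M volume (strongDualBasis b).addHaar :=
    ⟨M.continuous.measurable, hM3⟩
  have eL : MeasurableEmbedding L := L.toHomeomorph.measurableEmbedding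
  have eM : MeasurableEmbedding M := M.toHomeomorph.measurableEmbedding
  have k1 : Integrable (h ∘ L) := (mpL.integrable_comp_emb eL).2 h1
  have k2 : MemLp (h ∘ L) 2 := h2.comp_measurePreserving mpL
  have key := lintegral_fourier_sq k1 k2
  have hpi : (-(2 * Real.pi)⁻¹) ≠ 0 := by simp [Real.pi_ne_zero]
  -- The kernel of `𝓕` is `e^{-2πi⟨u, v⟩}`, whence the dilation by `-(2π)⁻¹`. Its Jacobian `(2π)ⁿ`
  -- and the factor `c²` from the squared integral are balanced by `((2π)ⁿ c)⁻¹` in `dualHaar`,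
  -- which leaves one factor `c`.
  have s1 : ∀ v, ∫ X, Complex.exp (Complex.I * (M v X : ℂ)) * h X ∂(c • b.addHaar) =
      c.toReal • 𝓕 (h ∘ L) ((-(2 * Real.pi)⁻¹) • v) := by
    intro v
    rw [integral_smul_measure, ← mpL.integral_comp eL, Real.fourier_eq']
    congr 1
    refine integral_congr_ae (ae_of_all _ fun u ↦ ?_)
    simp only [hLM, inner_smul_right, Function.comp, smul_eq_mul]
    congr 2
    rw [mul_comm]
    congr 2
    field_simp
  have s2 : ∫⁻ v, ‖𝓕 (h ∘ L) ((-(2 * Real.pi)⁻¹) • v)‖ₑ ^ 2 =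
      ENNReal.ofReal ((2 * Real.pi) ^ finrank ℝ E) * ∫⁻ v, ‖𝓕 (h ∘ L) v‖ₑ ^ 2 := by
    have := lintegral_map (μ := (volume : Measure (EuclideanSpace ℝ (Fin (finrank ℝ E)))))
      (f := fun v ↦ ‖𝓕 (h ∘ L) v‖ₑ ^ 2)
      (g := fun v ↦ (-(2 * Real.pi)⁻¹) • v)
      (k1.continuous_fourier.measurable.enorm.pow_const 2) (measurable_const_smul _)
    rw [← this, Measure.map_addHaar_smul _ hpi, lintegral_smul_measure]
    simp [abs_pow, abs_of_pos Real.pi_pos]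
    rw [← inv_pow, show (Real.pi⁻¹ * 2⁻¹)⁻¹ = 2 * Real.pi by field_simp]
  rw [dualHaar_smul_addHaar, lintegral_smul_measure, ← mpM.lintegral_comp_emb eM]
  simp_rw [s1]
  simp only [enorm_smul, mul_pow ‖c.toReal‖ₑ]
  rw [lintegral_const_mul _ (by
    exact (k1.continuous_fourier.measurable.comp (measurable_const_smul _)).enorm.pow_const 2),
    s2, key, lintegral_smul_measure, ← mpL.lintegral_comp_emb eL]
  have hcc : ‖c.toReal‖ₑ = c := by
    rw [Real.enorm_eq_ofReal ENNReal.toReal_nonneg, ENNReal.ofReal_toReal hc']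
  rw [hcc]
  have hP0 : ENNReal.ofReal ((2 * Real.pi) ^ finrank ℝ E) ≠ 0 := by
    simp; positivity
  have hPT : ENNReal.ofReal ((2 * Real.pi) ^ finrank ℝ E) ≠ ⊤ := ENNReal.ofReal_ne_top
  simp only [smul_eq_mul, Function.comp]
  generalize ENNReal.ofReal ((2 * Real.pi) ^ finrank ℝ E) = P at *
  rw [ENNReal.mul_inv (Or.inl hP0) (Or.inl hPT)]
  calc _ = (P⁻¹ * P) * (c⁻¹ * c) * (c * ∫⁻ v, ‖h (L v)‖ₑ ^ 2) := by ring
    _ = _ := by rw [ENNReal.inv_mul_cancel hP0 hPT, ENNReal.inv_mul_cancel hc hc', one_mul, one_mul]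

end Plancherel

end

/-! ### Singular values and the Schatten bound for Bessel families. -/

noncomputable section

section SingularValues

open Set Filter Topology TopologicalSpace

variable {H : Type*} [NormedAddCommGroup H] [InnerProductSpace ℂ H] [CompleteSpace H]

omit [CompleteSpace H] in
theorem Orthonormal.tsum_enorm_inner_sq_le {ι : Type*} {v : ι → H} (hv : Orthonormal ℂ v) (x : H) :
    ∑' i, ‖⟪v i, x⟫_ℂ‖ₑ ^ 2 ≤ ‖x‖ₑ ^ 2 := by
  have h1 : ∀ i, ‖⟪v i, x⟫_ℂ‖ₑ ^ 2 = ENNReal.ofReal (‖⟪v i, x⟫_ℂ‖ ^ 2) := fun i ↦ by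
    rw [ENNReal.ofReal_pow (norm_nonneg _), ofReal_norm]
  simp_rw [h1]
  rw [← ENNReal.ofReal_tsum_of_nonneg (fun i ↦ by positivity) (hv.inner_products_summable x),
    ← ofReal_norm, ← ENNReal.ofReal_pow (norm_nonneg _)]
  exact ENNReal.ofReal_le_ofReal (hv.tsum_inner_products_le x)

theorem ENNReal.tsum_mul_le_of_tsum_sq_le_one {ι : Type*} {a b : ι → ℝ≥0∞}
    (ha : ∑' i, a i ^ 2 ≤ 1) (hb : ∑' i, b i ^ 2 ≤ 1) : ∑' i, a i * b i ≤ 1 := by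
  rw [ENNReal.tsum_eq_iSup_sum]
  refine iSup_le fun s ↦ ?_
  have h := ENNReal.inner_le_Lp_mul_Lq s a b Real.HolderConjugate.two_two
  refine h.trans ?_
  simp only [ENNReal.rpow_two]
  have h1 : ∀ c : ι → ℝ≥0∞, ∑' i, c i ^ 2 ≤ 1 → (∑ i ∈ s, c i ^ 2) ^ (1 / (2 : ℝ)) ≤ 1 :=
    fun c hc ↦ ENNReal.rpow_le_one ((ENNReal.sum_le_tsum s).trans hc) (by norm_num)
  exact mul_le_one' (h1 a ha) (h1 b hb)

/-- Jensen's inequality for a subprobability: the missing mass only helps, as the total mass occurs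
with the nonnegative exponent `1 - q⁻¹`. -/
theorem ENNReal.tsum_mul_rpow_le {ι : Type*} {a s : ι → ℝ≥0∞} (ha : ∑' i, a i ≤ 1) {q : ℝ}
    (hq : 1 ≤ q) : (∑' i, s i * a i) ^ q ≤ ∑' i, s i ^ q * a i := by
  have hq0 : 0 < q := by linarith
  rw [← ENNReal.le_rpow_inv_iff hq0]
  rw [ENNReal.tsum_eq_iSup_sum]
  refine iSup_le fun F ↦ ?_
  have h := ENNReal.inner_le_weight_mul_Lp_of_nonneg F hq a s
  calc ∑ i ∈ F, s i * a i = ∑ i ∈ F, a i * s i := by simp_rw [mul_comm]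
    _ ≤ _ := h
    _ ≤ 1 * (∑' i, s i ^ q * a i) ^ q⁻¹ := by
        gcongr
        · refine ENNReal.rpow_le_one ((ENNReal.sum_le_tsum F).trans ha) ?_
          have := inv_le_one_of_one_le₀ hq
          linarith
        · simp_rw [mul_comm (a _)]
          exact ENNReal.sum_le_tsum F
    _ = _ := one_mul _

/-- The index set of the positive singular values of an operator, with multiplicity. -/
abbrev SingularIndex (T : H →L[ℂ] H) : Type :=
  Σ s : Ioi (0 : ℝ), Fin (singularMultiplicity T s)

/-- The singular value decomposition of a compact operator. -/
theorem IsCompactOperator.exists_singular_vectors {T : H →L[ℂ] H} (hT : IsCompactOperator T) :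
    ∃ e f : SingularIndex T → H, Orthonormal ℂ e ∧ Orthonormal ℂ f ∧
      (∀ i, T (e i) = ((i.1 : ℝ) : ℂ) • f i) ∧
      ∀ u, (∀ i, ⟪e i, u⟫_ℂ = 0) → T u = 0 := by
  set S : H →L[ℂ] H := ContinuousLinearMap.adjoint T ∘L T with hS
  have hSc : IsCompactOperator S := hT.clm_comp (ContinuousLinearMap.adjoint T)
  have hSs : ∀ x y, ⟪x, S y⟫_ℂ = ⟪T x, T y⟫_ℂ := fun x y ↦ by
    simp [hS, ContinuousLinearMap.adjoint_inner_right]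
  have hsym : (S : H →ₗ[ℂ] H).IsSymmetric := fun x y ↦ by
    change ⟪S x, y⟫_ℂ = ⟪x, S y⟫_ℂ
    rw [hSs, ← inner_conj_symm, hSs, inner_conj_symm]
  let ev : Ioi (0 : ℝ) → ℂ := fun s ↦ (((s : ℝ) ^ 2 : ℝ) : ℂ)
  have hev : Function.Injective ev := fun s t h ↦ by
    have h1 : (s : ℝ) ^ 2 = (t : ℝ) ^ 2 := Complex.ofReal_injective h
    exact Subtype.ext ((pow_left_inj₀ (le_of_lt s.2) (le_of_lt t.2) two_ne_zero).1 h1)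
  have hev0 : ∀ s, ev s ≠ 0 := fun s ↦ by
    have : (0 : ℝ) < s := s.2
    simp only [ev, ne_eq, Complex.ofReal_eq_zero]
    positivity
  -- Compactness makes `finrank` the true multiplicity, so that bases indexed by `Fin` exist.
  have hfin : ∀ s, FiniteDimensional ℂ (End.eigenspace (S : H →ₗ[ℂ] H) (ev s)) := fun s ↦
    ContinuousLinearMap.finite_dimensional_eigenspace hSc _ (hev0 s)
  let V : ∀ s : Ioi (0 : ℝ), OrthonormalBasis (Fin (singularMultiplicity T s)) ℂ
      (End.eigenspace (S : H →ₗ[ℂ] H) (ev s)) := fun s ↦ stdOrthonormalBasis ℂ _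
  let e : SingularIndex T → H := fun i ↦ V i.1 i.2
  have he : Orthonormal ℂ e :=
    (hsym.orthogonalFamily_eigenspaces.comp hev).orthonormal_sigma_orthonormal
      (fun s ↦ (V s).orthonormal)
  have hSe : ∀ i, S (e i) = ev i.1 • e i := fun i ↦
    End.mem_eigenspace_iff.1 (V i.1 i.2).2
  have hpos : ∀ i : SingularIndex T, (0 : ℝ) < i.1 := fun i ↦ i.1.2
  let f : SingularIndex T → H := fun i ↦ ((i.1 : ℝ) : ℂ)⁻¹ • T (e i)
  have hTe : ∀ i, T (e i) = ((i.1 : ℝ) : ℂ) • f i := fun i ↦ by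
    have : ((i.1 : ℝ) : ℂ) ≠ 0 := by exact_mod_cast (hpos i).ne'
    simp [f, smul_smul, this]
  refine ⟨e, f, he, ?_, hTe, ?_⟩
  · classical
    rw [orthonormal_iff_ite] at he ⊢
    intro i j
    have hi : ((i.1 : ℝ) : ℂ) ≠ 0 := by exact_mod_cast (hpos i).ne'
    simp only [f, inner_smul_left, inner_smul_right, ← hSs, hSe, he]
    split_ifs with hij
    · subst hij
      simp only [ev]
      simp
      field_simp
    · simp
  · intro u hu
    have hu' : ∀ s, ∀ v ∈ End.eigenspace (S : H →ₗ[ℂ] H) (ev s), ⟪v, u⟫_ℂ = 0 := by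
      intro s v hv
      have h1 := (V s).sum_repr ⟨v, hv⟩
      have h2 : v = ∑ i, (V s).repr ⟨v, hv⟩ i • (V s i : H) := by
        have := congrArg Subtype.val h1
        simpa using this.symm
      rw [h2, sum_inner]
      refine Finset.sum_eq_zero fun i _ ↦ ?_
      rw [inner_smul_left, hu ⟨s, i⟩, mul_zero]
    -- `S u` is orthogonal to every eigenspace: those with nonzero eigenvalue belong to some `s >
    -- 0`, with `s = ‖T v‖ / ‖v‖`, and the kernel is orthogonal to the range. The spectral theorem
    -- for compact symmetric operators then gives 0.
    have hSu : S u = 0 := by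
      have h1 : S u ∈ (⨆ μ, End.eigenspace (S : H →ₗ[ℂ] H) μ)ᗮ := by
        rw [← Submodule.iInf_orthogonal, Submodule.mem_iInf]
        intro μ
        rw [Submodule.mem_orthogonal]
        intro v hv
        have hSv : S v = μ • v := End.mem_eigenspace_iff.1 hv
        rw [← show ⟪S v, u⟫_ℂ = ⟪v, S u⟫_ℂ from hsym v u, hSv, inner_smul_left]
        by_cases hv0 : v = 0
        · simp [hv0]
        by_cases hμ : μ = 0
        · simp [hμ]
        have hn : (‖v‖ : ℂ) ≠ 0 := by simpa using hv0
        have h3 : μ * (‖v‖ : ℂ) ^ 2 = (‖T v‖ : ℂ) ^ 2 := by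
          have := hSs v v
          rw [hSv, inner_smul_right, inner_self_eq_norm_sq_to_K, inner_self_eq_norm_sq_to_K] at this
          exact this
        have h4 : μ = (((‖T v‖ / ‖v‖) ^ 2 : ℝ) : ℂ) := by
          push_cast
          rw [div_pow, eq_div_iff (pow_ne_zero 2 hn), h3]
        have h5 : 0 < ‖T v‖ / ‖v‖ := by
          refine lt_of_le_of_ne (by positivity) fun h ↦ hμ ?_
          rw [h4, ← h]; simp
        rw [h4] at hv
        rw [hu' ⟨_, h5⟩ v hv, mul_zero]
      rw [ContinuousLinearMap.orthogonalComplement_iSup_eigenspaces_eq_bot hSc hsym] at h1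
      exact (Submodule.mem_bot ℂ).1 h1
    have h6 := hSs u u
    rw [hSu, inner_zero_right] at h6
    exact inner_self_eq_zero.1 h6.symm

/-- Parseval's identity for `⟨T† u, u⟩` in a Hilbert basis extending `e`; the added basis vectors
are orthogonal to all `e i`, hence killed by `T`. -/
theorem enorm_inner_apply_le_tsum {ι : Type*} {T : H →L[ℂ] H} {e f : ι → H} {s : ι → ℝ}
    (hs : ∀ i, 0 ≤ s i)
    (he : Orthonormal ℂ e) (hTe : ∀ i, T (e i) = (s i : ℂ) • f i)
    (hT : ∀ u, (∀ i, ⟪e i, u⟫_ℂ = 0) → T u = 0) (u : H) :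
    ‖⟪u, T u⟫_ℂ‖ₑ ≤ ∑' i, ENNReal.ofReal (s i) * (‖⟪e i, u⟫_ℂ‖ₑ * ‖⟪f i, u⟫_ℂ‖ₑ) := by
  obtain ⟨w, b, hw, hb⟩ := he.toSubtypeRange.exists_hilbertBasis_extension
  have h1 := b.tsum_inner_mul_inner (ContinuousLinearMap.adjoint T u) u
  rw [ContinuousLinearMap.adjoint_inner_left] at h1
  rw [← h1]
  refine (enorm_tsum_le_tsum_enorm).trans (le_of_eq ?_)
  let g : ι → w := fun i ↦ ⟨e i, hw (mem_range_self i)⟩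
  have hg : Function.Injective g := fun i j h ↦ he.linearIndependent.injective
    (congrArg Subtype.val h)
  have hbg : ∀ i, b (g i) = e i := fun i ↦ by rw [hb]
  rw [← hg.tsum_eq]
  · refine tsum_congr fun i ↦ ?_
    rw [ContinuousLinearMap.adjoint_inner_left, hbg, hTe, inner_smul_right, enorm_mul, enorm_mul,
      ← inner_conj_symm (f i) u, RCLike.enorm_conj]
    have : ‖(s i : ℂ)‖ₑ = ENNReal.ofReal (s i) := by
      rw [← ofReal_norm, Complex.norm_of_nonneg (hs i)]
    rw [this]
    ring
  · intro v hv
    by_contra hvg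
    refine hv ?_
    have h2 : T (b v) = 0 := hT _ fun i ↦ by
      rw [← hbg i]
      exact b.orthonormal.2 fun h ↦ hvg ⟨i, h⟩
    simp [ContinuousLinearMap.adjoint_inner_left, h2]

/-- The Schatten bound for the integral of the symbol of an operator against a family of unit
vectors which satisfies a Bessel inequality. -/
theorem lintegral_enorm_inner_rpow_le {α : Type*} [MeasurableSpace α] {P : Measure α} {a : α → H}
    (ha : ∀ x, ‖a x‖ₑ ≤ 1) (hm : ∀ u, AEMeasurable (fun x ↦ ⟪u, a x⟫_ℂ) P)
    (hB : ∀ u, ∫⁻ x, ‖⟪u, a x⟫_ℂ‖ₑ ^ 2 ∂P ≤ ‖u‖ₑ ^ 2) {T : H →L[ℂ] H}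
    (hT : IsCompactOperator T) {q : ℝ} (hq : 1 ≤ q) :
    ∫⁻ x, ‖⟪a x, T (a x)⟫_ℂ‖ₑ ^ q ∂P ≤ ∑' s : Ioi (0 : ℝ),
      (singularMultiplicity T s : ℝ≥0∞) * ENNReal.ofReal s ^ q := by
  have hq0 : 0 < q := by linarith
  obtain ⟨e, f, he, hf, hTe, hT0⟩ := hT.exists_singular_vectors
  have hsum : ∑' s : Ioi (0 : ℝ), (singularMultiplicity T s : ℝ≥0∞) * ENNReal.ofReal s ^ q =
      ∑' i : SingularIndex T, ENNReal.ofReal i.1 ^ q := by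
    rw [ENNReal.tsum_sigma']
    simp
  rw [hsum]
  by_cases htop : ∑' i : SingularIndex T, ENNReal.ofReal i.1 ^ q = ⊤
  · rw [htop]; exact le_top
  -- A finite sum of positive terms has countably many terms; countability permits the exchange of
  -- sum and integral below.
  have hcount : Countable (SingularIndex T) := by
    have h1 := Summable.countable_support_ennreal htop
    rw [← countable_univ_iff]
    refine h1.mono fun i _ ↦ ?_
    have : (0 : ℝ) < i.1 := i.1.2
    simp only [Function.mem_support]
    exact (ENNReal.rpow_pos (by simpa using this) ENNReal.ofReal_ne_top).ne'
  have hbes : ∀ v : SingularIndex T → H, Orthonormal ℂ v → ∀ x,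
      ∑' i, ‖⟪v i, a x⟫_ℂ‖ₑ ^ 2 ≤ 1 := fun v hv x ↦
    (hv.tsum_enorm_inner_sq_le (a x)).trans (pow_le_one' (ha x) 2)
  have hpt : ∀ x, ‖⟪a x, T (a x)⟫_ℂ‖ₑ ^ q ≤ ∑' i : SingularIndex T,
      ENNReal.ofReal i.1 ^ q * (‖⟪e i, a x⟫_ℂ‖ₑ * ‖⟪f i, a x⟫_ℂ‖ₑ) := by
    intro x
    refine (ENNReal.rpow_le_rpow (enorm_inner_apply_le_tsum (fun i ↦ le_of_lt i.1.2) he hTe hT0 _)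
      hq0.le).trans ?_
    exact ENNReal.tsum_mul_rpow_le (ENNReal.tsum_mul_le_of_tsum_sq_le_one (hbes e he x)
      (hbes f hf x)) hq
  refine (lintegral_mono hpt).trans ?_
  have hm2 : ∀ u, AEMeasurable (fun x ↦ ‖⟪u, a x⟫_ℂ‖ₑ) P := fun u ↦ (hm u).enorm
  have hm3 : ∀ i, AEMeasurable (fun x ↦ ‖⟪e i, a x⟫_ℂ‖ₑ * ‖⟪f i, a x⟫_ℂ‖ₑ) P := fun i ↦
    (hm2 (e i)).mul (hm2 (f i))
  rw [lintegral_tsum fun i ↦ (hm3 i).const_mul _]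
  refine ENNReal.tsum_le_tsum fun i ↦ ?_
  rw [lintegral_const_mul'' _ (hm3 i)]
  refine mul_le_of_le_one_right' ?_
  -- Cauchy-Schwarz over the phase space, where the Bessel inequality of the family bounds each
  -- factor by 1.
  have h2 := ENNReal.lintegral_mul_le_Lp_mul_Lq P Real.HolderConjugate.two_two (hm2 (e i))
    (hm2 (f i))
  refine h2.trans ?_
  have h3 : ∀ u : H, ‖u‖ = 1 → (∫⁻ x, ‖⟪u, a x⟫_ℂ‖ₑ ^ (2 : ℝ) ∂P) ^ (1 / (2 : ℝ)) ≤ 1 := by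
    intro u hu
    refine ENNReal.rpow_le_one ?_ (by norm_num)
    simp only [ENNReal.rpow_two]
    refine (hB u).trans ?_
    rw [← ofReal_norm, hu]
    simp
  exact mul_le_one' (h3 _ (he.1 i)) (h3 _ (hf.1 i))

omit [CompleteSpace H] in
theorem Orthonormal.countable_of_separableSpace [SeparableSpace H] {ι : Type*} {v : ι → H}
    (hv : Orthonormal ℂ v) : Countable ι := by
  refine Pairwise.countable_of_isOpen_disjoint (s := fun i ↦ Metric.ball (v i) (1 / 2))
    (fun i j hij ↦ Metric.ball_disjoint_ball ?_) (fun i ↦ Metric.isOpen_ball)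
    fun i ↦ Metric.nonempty_ball.2 (by norm_num)
  -- By Cauchy-Schwarz distinct vectors are at distance at least 1, so the balls of radius `1 / 2`
  -- are disjoint.
  have h1 : ⟪v i, v i - v j⟫_ℂ = 1 := by
    rw [inner_sub_right, hv.2 hij, sub_zero, inner_self_eq_norm_sq_to_K, hv.1 i]
    simp
  have h2 := norm_inner_le_norm (𝕜 := ℂ) (v i) (v i - v j)
  rw [h1, hv.1 i, one_mul, norm_one, ← dist_eq_norm] at h2
  linarith

/-- A weakly measurable map into a separable Hilbert space has measurable symbols. -/
theorem measurable_inner_apply_of_weak {α : Type*} [MeasurableSpace α] [SecondCountableTopology H]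
    {a : α → H} (hm : ∀ u, Measurable (fun x ↦ ⟪u, a x⟫_ℂ)) (T : H →L[ℂ] H) :
    Measurable fun x ↦ ⟪a x, T (a x)⟫_ℂ := by
  obtain ⟨w, b, hb⟩ := exists_hilbertBasis ℂ H
  have hcount : Countable w := b.orthonormal.countable_of_separableSpace
  have h1 : ∀ u, Measurable (fun x ↦ ⟪a x, u⟫_ℂ) := fun u ↦ by
    simp_rw [← inner_conj_symm _ u]
    exact Complex.continuous_conj.measurable.comp (hm u)
  -- Parseval in a countable basis writes the symbol as a limit of measurable finite sums.
  have h2 : ∀ x, HasSum (fun i ↦ ⟪a x, b i⟫_ℂ * ⟪ContinuousLinearMap.adjoint T (b i), a x⟫_ℂ)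
      ⟪a x, T (a x)⟫_ℂ := fun x ↦ by
    simpa only [ContinuousLinearMap.adjoint_inner_left] using
      b.hasSum_inner_mul_inner (a x) (T (a x))
  refine measurable_of_tendsto_metrizable' (atTop : Filter (Finset w))
    (f := fun s x ↦ ∑ i ∈ s, ⟪a x, b i⟫_ℂ * ⟪ContinuousLinearMap.adjoint T (b i), a x⟫_ℂ)
    (fun s ↦ ?_) (tendsto_pi_nhds.2 fun x ↦ h2 x)
  exact Finset.measurable_fun_sum s fun i _ ↦ (h1 _).mul (hm _)

end SingularValues

end

/-! ### Coherent states and their Bessel inequality. -/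

noncomputable section

section CoherentStates

open Set Filter Topology ComplexConjugate

variable {E : Type*} [NormedAddCommGroup E] [NormedSpace ℝ E]
  [MeasurableSpace E] [BorelSpace E]
  {G : Type*} [TopologicalSpace G] [ChartedSpace E G] [Group G]
  [IsTopologicalGroup G] [SecondCountableTopology G] [MeasurableSpace G] [BorelSpace G]
  {μ : Measure G} [SigmaFinite μ] [μ.IsMulLeftInvariant]

omit [IsTopologicalGroup G] [SecondCountableTopology G] [BorelSpace G] in
theorem measurable_phase (hlog : Measurable (lieLog : G → E)) (ζ : StrongDual ℝ E) :
    Measurable fun y : G ↦ Complex.exp (-(Complex.I * (ζ (lieLog y) : ℂ))) := by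
  have : Measurable fun y : G ↦ ζ (lieLog y) := ζ.continuous.measurable.comp hlog
  fun_prop

theorem norm_phase (r : ℝ) : ‖Complex.exp (-(Complex.I * (r : ℂ)))‖ = 1 := by
  rw [show -(Complex.I * (r : ℂ)) = ((-r : ℝ) : ℂ) * Complex.I by push_cast; ring,
    Complex.norm_exp_ofReal_mul_I]

omit [SigmaFinite μ] in
omit [SecondCountableTopology G] in
theorem eLpNorm_weylAdjoint (hlog : Measurable (lieLog : G → E)) (z : G) (ζ : StrongDual ℝ E)
    {w : G → ℂ} (hw : AEStronglyMeasurable w μ) :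
    AEStronglyMeasurable (weylAdjoint z ζ w) μ ∧ eLpNorm (weylAdjoint z ζ w) 2 μ = eLpNorm w 2 μ := by
  have h1 : AEStronglyMeasurable
      (fun y ↦ Complex.exp (-(Complex.I * (ζ (lieLog y) : ℂ))) * w y) μ :=
    (measurable_phase hlog ζ).aestronglyMeasurable.mul hw
  have h2 := measurePreserving_mul_left μ z
  refine ⟨h1.comp_measurePreserving h2, ?_⟩
  refine (eLpNorm_comp_measurePreserving h1 h2).trans (eLpNorm_congr_norm_ae (ae_of_all _ fun y ↦ ?_))
  rw [norm_mul, norm_phase, one_mul]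

omit [SigmaFinite μ] in
omit [SecondCountableTopology G] in
theorem memLp_weylAdjoint (hlog : Measurable (lieLog : G → E)) (w : Lp ℂ 2 μ)
    (X : G × StrongDual ℝ E) : MemLp (weylAdjoint X.1 X.2 w) 2 μ := by
  obtain ⟨h1, h2⟩ := eLpNorm_weylAdjoint hlog X.1 X.2 (Lp.aestronglyMeasurable w)
  exact ⟨h1, h2 ▸ Lp.eLpNorm_lt_top w⟩

omit [SigmaFinite μ] in
omit [SecondCountableTopology G] in
theorem norm_coherentState (hlog : Measurable (lieLog : G → E)) (w : Lp ℂ 2 μ)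
    (X : G × StrongDual ℝ E) : ‖coherentState μ w X‖ = ‖w‖ := by
  rw [coherentState, dif_pos (memLp_weylAdjoint hlog w X), Lp.norm_toLp, Lp.norm_def,
    (eLpNorm_weylAdjoint hlog X.1 X.2 (Lp.aestronglyMeasurable w)).2]

omit [SigmaFinite μ] in
omit [SecondCountableTopology G] in
-- The substitution `y = z x` frees the phase from `z`: for fixed `z` this is a Fourier integral in
-- `ζ`, in logarithmic coordinates.
theorem inner_coherentState (hlog : Measurable (lieLog : G → E)) (w u : Lp ℂ 2 μ)
    (X : G × StrongDual ℝ E) : ⟪coherentState μ w X, u⟫_ℂ =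
      ∫ y, Complex.exp (Complex.I * (X.2 (lieLog y) : ℂ)) * (conj (w y) * u (X.1⁻¹ * y)) ∂μ := by
  rw [← integral_mul_left_eq_self _ X.1, coherentState, dif_pos (memLp_weylAdjoint hlog w X),
    L2.inner_def]
  refine integral_congr_ae ?_
  filter_upwards [(memLp_weylAdjoint hlog w X).coeFn_toLp] with x hx
  rw [hx, weylAdjoint, RCLike.inner_apply, inv_mul_cancel_left, map_mul, ← Complex.exp_conj]
  simp only [map_neg, map_mul, Complex.conj_I, Complex.conj_ofReal]
  ring_nf

theorem measurable_inner_coherentState [FiniteDimensional ℝ E]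
    (hlog : Measurable (lieLog : G → E)) (w u : Lp ℂ 2 μ) :
    Measurable fun X : G × StrongDual ℝ E ↦ ⟪u, coherentState μ w X⟫_ℂ := by
  have hu := (Lp.stronglyMeasurable u).measurable
  have hw := (Lp.stronglyMeasurable w).measurable
  have h1 : Measurable fun q : (G × StrongDual ℝ E) × G ↦ q.1.2 (lieLog q.2) := by
    have hc : Continuous fun q : StrongDual ℝ E × E ↦ q.1 q.2 := by fun_prop
    exact hc.measurable.comp (Measurable.prodMk (by fun_prop) (hlog.comp measurable_snd))
  have h2 : Measurable fun q : (G × StrongDual ℝ E) × G ↦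
      Complex.exp (Complex.I * (q.1.2 (lieLog q.2) : ℂ)) *
        (conj (w q.2) * u (q.1.1⁻¹ * q.2)) := by
    refine Measurable.mul (by fun_prop) (Measurable.mul ?_ ?_)
    · exact Complex.continuous_conj.measurable.comp (hw.comp measurable_snd)
    · exact hu.comp (by fun_prop)
  have h3 := (h2.stronglyMeasurable.integral_prod_right' (ν := μ)).measurable
  simp_rw [← inner_conj_symm u]
  refine Complex.continuous_conj.measurable.comp ?_
  simp_rw [inner_coherentState hlog w u]
  exact h3

variable [FiniteDimensional ℝ E] [μ.IsInvInvariant] [μ.IsMulRightInvariant]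

omit [TopologicalSpace G] [Group G] [IsTopologicalGroup G] [SecondCountableTopology G]
  [BorelSpace G] [SigmaFinite μ] [μ.IsMulLeftInvariant] [μ.IsInvInvariant] [μ.IsMulRightInvariant] in
theorem lintegral_enorm_sq_eq (u : Lp ℂ 2 μ) : ∫⁻ y, ‖u y‖ₑ ^ 2 ∂μ = ‖u‖ₑ ^ 2 := by
  have := eLpNorm_nnreal_pow_eq_lintegral (f := u) (μ := μ) (p := 2) (by norm_num)
  simp only [NNReal.coe_ofNat, ENNReal.rpow_ofNat, ENNReal.coe_ofNat] at this
  rw [← this, Lp.enorm_def]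

omit [SigmaFinite μ] [μ.IsMulLeftInvariant] [μ.IsInvInvariant] [μ.IsMulRightInvariant] in
theorem measurable_translate_sq (w u : Lp ℂ 2 μ) :
    Measurable fun q : G × G ↦ ‖conj (w q.2) * u (q.1⁻¹ * q.2)‖ₑ ^ 2 := by
  have hu := (Lp.stronglyMeasurable u).measurable
  have hw := (Lp.stronglyMeasurable w).measurable
  refine Measurable.pow_const (Measurable.enorm (Measurable.mul ?_ ?_)) 2
  · exact Complex.continuous_conj.measurable.comp (hw.comp measurable_snd)
  · exact hu.comp (by fun_prop)

omit [μ.IsMulLeftInvariant] in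
-- By Tonelli the integral over `z` comes first; there `z ↦ z⁻¹` and a right translation by `y` are
-- used, which is where unimodularity enters.
theorem lintegral_lintegral_enorm_translate_sq (w u : Lp ℂ 2 μ) :
    ∫⁻ z, ∫⁻ y, ‖conj (w y) * u (z⁻¹ * y)‖ₑ ^ 2 ∂μ ∂μ = ‖w‖ₑ ^ 2 * ‖u‖ₑ ^ 2 := by
  have hu := (Lp.stronglyMeasurable u).measurable
  have hw := (Lp.stronglyMeasurable w).measurable
  rw [lintegral_lintegral_swap (measurable_translate_sq w u).aemeasurable]
  have h1 : ∀ y, ∫⁻ z, ‖conj (w y) * u (z⁻¹ * y)‖ₑ ^ 2 ∂μ = ‖w y‖ₑ ^ 2 * ‖u‖ₑ ^ 2 := by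
    intro y
    simp_rw [enorm_mul, mul_pow, RCLike.enorm_conj]
    rw [lintegral_const_mul]
    · congr 1
      have := lintegral_inv_eq_self (μ := μ) (fun z ↦ ‖u (z * y)‖ₑ ^ 2)
      rw [this, lintegral_mul_right_eq_self (fun z ↦ ‖u z‖ₑ ^ 2) y, lintegral_enorm_sq_eq]
    · exact (hu.comp (by fun_prop)).enorm.pow_const 2
  simp_rw [h1]
  rw [lintegral_mul_const _ (hw.enorm.pow_const 2), lintegral_enorm_sq_eq]

/-- The coherent states satisfy a Bessel inequality (square integrability of the Weyl system). -/
theorem lintegral_inner_coherentState_sq_le (Φ : E ≃ₜ G) (hΦ : ∀ g, Φ.symm g = lieLog g)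
    {c : ℝ≥0∞} (hc0 : c ≠ 0) (hc : c ≠ ⊤) (hμ : μ = c • (finBasis ℝ E).addHaar.map Φ)
    (w u : Lp ℂ 2 μ) : ∫⁻ X, ‖⟪u, coherentState μ w X⟫_ℂ‖ₑ ^ 2 ∂phaseMeasure (E := E) μ ≤
      ‖w‖ₑ ^ 2 * ‖u‖ₑ ^ 2 := by
  have hlog : Measurable (lieLog : G → E) := by
    rw [← show (Φ.symm : G → E) = lieLog from funext hΦ]
    exact Φ.symm.continuous.measurable
  have hu := (Lp.stronglyMeasurable u).measurable
  have hw := (Lp.stronglyMeasurable w).measurable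
  have hm : lieAlgebraHaar (E := E) μ = c • (finBasis ℝ E).addHaar := lieAlgebraHaar_eq_smul Φ hΦ hμ
  have hmap : μ = (c • (finBasis ℝ E).addHaar).map Φ := by rw [Measure.map_smul, ← hμ]
  have eΦ : MeasurableEmbedding Φ := Φ.measurableEmbedding
  have mpΦ : MeasurePreserving Φ (c • (finBasis ℝ E).addHaar) μ :=
    ⟨Φ.continuous.measurable, hmap.symm⟩
  have hlΦ : ∀ X, lieLog (Φ X) = X := fun X ↦ by rw [← hΦ, Φ.symm_apply_apply]
  -- Only this half of Tonelli's theorem is needed for a Bessel inequality.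
  refine (lintegral_prod_le _).trans ?_
  rw [← lintegral_lintegral_enorm_translate_sq w u, hm]
  -- Plancherel is applied slice by slice. A slice is always in `L¹`, as a product of two `L²`
  -- functions, but in `L²` only for almost every `z`.
  have hfin : ∀ᵐ z ∂μ, ∫⁻ y, ‖conj (w y) * u (z⁻¹ * y)‖ₑ ^ 2 ∂μ < ⊤ := by
    refine ae_lt_top (measurable_translate_sq w u).lintegral_prod_right' ?_
    rw [lintegral_lintegral_enorm_translate_sq]
    exact ENNReal.mul_ne_top (by simp) (by simp)
  refine lintegral_mono_ae ?_
  filter_upwards [hfin] with z hz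
  set F : G → ℂ := fun y ↦ conj (w y) * u (z⁻¹ * y) with hF
  have hFm : Measurable F :=
    (Complex.continuous_conj.measurable.comp hw).mul (hu.comp (by fun_prop))
  have hF1 : Integrable F μ := by
    have h2 : MemLp (fun y ↦ u (z⁻¹ * y)) 2 μ :=
      (Lp.memLp u).comp_measurePreserving (measurePreserving_mul_left μ z⁻¹)
    have h3 : MemLp (fun y ↦ conj (w y)) 2 μ := (Lp.memLp w).star
    exact h3.integrable_mul h2
  have hF2 : MemLp F 2 μ := by
    refine ⟨hFm.aestronglyMeasurable, ?_⟩
    have := eLpNorm_nnreal_pow_eq_lintegral (f := F) (μ := μ) (p := 2) (by norm_num)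
    simp only [NNReal.coe_ofNat, ENNReal.rpow_ofNat, ENNReal.coe_ofNat] at this
    rw [← this] at hz
    exact (ENNReal.pow_lt_top_iff.1 hz).resolve_right (by norm_num)
  have hF1' : Integrable (F ∘ Φ) (finBasis ℝ E).addHaar := by
    rw [← mpΦ.integrable_comp_emb eΦ] at hF1
    exact (integrable_smul_measure hc0 hc).1 hF1
  have hF2' : MemLp (F ∘ Φ) 2 (finBasis ℝ E).addHaar := by
    have := hF2.comp_measurePreserving mpΦ
    refine this.of_measure_le_smul (c := c⁻¹) (ENNReal.inv_ne_top.2 hc0) (le_of_eq ?_)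
    rw [smul_smul, ENNReal.inv_mul_cancel hc0 hc, one_smul]
  have key := lintegral_dualHaar_sq hc0 hc hF1' hF2'
  refine le_of_eq (Eq.trans ?_ (key.trans ?_))
  · refine lintegral_congr fun ζ ↦ ?_
    rw [← inner_conj_symm, RCLike.enorm_conj, inner_coherentState hlog, ← mpΦ.integral_comp eΦ]
    simp only [hlΦ]
    rfl
  · exact mpΦ.lintegral_comp_emb eΦ (fun y ↦ ‖F y‖ₑ ^ 2)

end CoherentStates

end

/-! ### The Schatten bound for covariant symbols. -/

/-- `G` is a connected simply connected nilpotent Lie group with Haar measure `μ`, and `w` is any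
unit vector of `L²(G)`. -/
theorem corollary5p5 {E : Type*} [NormedAddCommGroup E] [NormedSpace ℝ E] [FiniteDimensional ℝ E]
    [MeasurableSpace E] [BorelSpace E]
    {G : Type*} [TopologicalSpace G] [T2Space G] [ChartedSpace E G] [Group G]
    [LieGroup 𝓘(ℝ, E) ∞ G] [ConnectedSpace G] [SimplyConnectedSpace G]
    [LieRing.IsNilpotent (GroupLieAlgebra 𝓘(ℝ, E) G)]
    [MeasurableSpace G] [BorelSpace G] (μ : Measure G) [μ.IsHaarMeasure]
    (w : Lp ℂ 2 μ) (hw : ‖w‖ = 1) (p : ℝ≥0∞) (hp : 1 ≤ p)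
    (T : Lp ℂ 2 μ →L[ℂ] Lp ℂ 2 μ) (hT : MemSchatten p T) :
    MemLp (diagCovariantSymbol (E := E) μ w T) p (phaseMeasure μ) ∧
      eLpNorm (diagCovariantSymbol (E := E) μ w T) p (phaseMeasure μ) ≤ schattenNorm p T := by
  have := FiniteDimensional.complete ℝ E
  have := topologicalGroup_of_lieGroup (G := G) 𝓘(ℝ, E) ∞
  obtain ⟨C, N, h⟩ := exists_isNilpotentBracket_lieBr E G
  obtain ⟨Φ, hΦ, hΦ'⟩ := h.exists_homeomorph_gexp
  have : SecondCountableTopology G := Φ.symm.isEmbedding.secondCountableTopology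
  have : LocallyCompactSpace G := Φ.symm.isClosedEmbedding.locallyCompactSpace
  have : μ.IsInvInvariant := h.isInvInvariant_of_homeomorph Φ hΦ μ
  have : μ.IsMulRightInvariant := h.isMulRightInvariant_of_homeomorph Φ hΦ μ
  obtain ⟨c, hc0, hc, hμ⟩ := h.exists_map_eq_smul Φ hΦ (finBasis ℝ E).addHaar μ
  have hlog : Measurable (lieLog : G → E) := by
    rw [← show (Φ.symm : G → E) = lieLog from funext hΦ']
    exact Φ.symm.continuous.measurable
  have hw1 : ∀ X : G × StrongDual ℝ E, ‖coherentState μ w X‖ = 1 := fun X ↦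
    (norm_coherentState hlog w X).trans hw
  have hmw := fun u ↦ measurable_inner_coherentState (E := E) hlog w u
  have : Fact ((2 : ℝ≥0∞) ≠ ⊤) := ⟨ENNReal.ofNat_ne_top⟩
  have : Fact (1 ≤ p) := ⟨hp⟩
  have hmeas : Measurable (diagCovariantSymbol (E := E) μ w T) :=
    measurable_inner_apply_of_weak hmw T
  -- The symbol is measurable and the Schatten norm is finite, so the norm inequality includes
  -- membership in `L^p`.
  suffices hle : eLpNorm (diagCovariantSymbol (E := E) μ w T) p (phaseMeasure μ) ≤
      schattenNorm p T from
    ⟨⟨hmeas.aestronglyMeasurable, hle.trans_lt hT.2⟩, hle⟩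
  by_cases hpt : p = ⊤
  · subst hpt
    rw [schattenNorm, if_pos rfl, eLpNorm_exponent_top]
    refine eLpNormEssSup_le_of_ae_enorm_bound (Filter.Eventually.of_forall fun X ↦ ?_)
    rw [← ofReal_norm, ← ofReal_norm]
    refine ENNReal.ofReal_le_ofReal ((norm_inner_le_norm _ _).trans ?_)
    rw [hw1, one_mul]
    exact (T.le_opNorm _).trans (by rw [hw1, mul_one])
  · have hp0 : p ≠ 0 := (zero_lt_one.trans_le hp).ne'
    have hq : 1 ≤ p.toReal := (ENNReal.dichotomy p).resolve_left (by
      simp [hpt])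
    rw [schattenNorm, if_neg hpt, eLpNorm_eq_lintegral_rpow_enorm_toReal hp0 hpt]
    refine ENNReal.rpow_le_rpow ?_ (by positivity)
    refine lintegral_enorm_inner_rpow_le (fun X ↦ ?_) (fun u ↦ (hmw u).aemeasurable) (fun u ↦ ?_)
      hT.1 hq
    · rw [← ofReal_norm, hw1, ENNReal.ofReal_one]
    · refine (lintegral_inner_coherentState_sq_le Φ hΦ' hc0 hc hμ w u).trans (le_of_eq ?_)
      rw [← ofReal_norm w, hw]
      simp
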